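/- **Setting.** Let $J\in\{1,2,\dots\}\cup\{\infty\}$, $Y=\mathbb R^J$ with the product $\boldsymbol\gamma$ of standard Gaussian measures, $\mathcal S$ a real Banach space, and $\mathcal F=\{\boldsymbol\nu\in\mathbb N_0^J:\sum_j\nu_j<\infty\}$. Let $H_n$ be the Hermite polynomials orthonormal for $N(0,1)$. *Quadrature.* Let $\mathcal Q_l(g)=\sum_{k<m_l}w^l_k\,g(y^l_k)$, $l\ge 0$, with $m_0=1$, $m_l<m_{l+1}$ and $y^0_0=0$, be univariate rules such that (A.1) $\mathcal Q_l(p)=\int p\,dN(0,1)$ for all polynomials $p$ of degree $\le l$, and (A.2) $|\mathcal Q_l(H_n)|<2$ for all $n>l\ge 0$. Put $\triangle_{\boldsymbol\nu}(f)=\bigotimes_{j:\nu_j\ne0}(\mathcal Q_{\nu_j}-\mathcal Q_{\nu_j-1})(f)$, where the coordinates $j$ with $\nu_j=0$ are set to $0$, and $\mathcal Q_\Lambda(f)=\sum_{\boldsymbol\nu\in\Lambda}\triangle_{\boldsymbol\nu}(f)$ for finite $\Lambda\subset\mathcal F$. The set $\Lambda$ is *admissible* if $\boldsymbol\nu\in\Lambda$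 and $\mu_j\le\nu_j$ for all $j$ imply $\boldsymbol\mu\in\Lambda$. *Function.* Let $0<q<2$, let $(\tau_j)_{j\ge1}$ be positive with $(\tau_j^{-1})_{j\ge1}\in\ell^q(\mathbb N)$, and let $r>14/q$ be an integer. Let $f:Y\to\mathcal S$ have weak derivatives $\partial^{\boldsymbol\mu}f\in L^2_{\boldsymbol\gamma}(Y,\mathcal S)$ for all $\boldsymbol\mu\in\mathcal F$ with $|\boldsymbol\mu|_\infty\le r$ (including $\boldsymbol\mu=0$, $\partial^0f=f$), with $$B(f):=\sum_{|\boldsymbol\mu|_\infty\le r}\frac{\boldsymbol\tau^{2\boldsymbol\mu}}{\boldsymbol\mu!}\int_Y\|\partial^{\boldsymbol\mu}f\|_{\mathcal S}^2\,d\boldsymbol\gamma<\infty .$$ Weak derivatives are taken one coordinate at a time and are tested against smooth compactly supported functions of finitely many coordinates. Since $\mathcal Q_\Lambda$ evaluates $f$ at single points, suppose also that the values of $f$ at points $\boldsymbol y$ with finitely many nonzero coordinates are local averages: for some weights $w_j>0$ (which may depend on $\boldsymbol y$) such that all boxes $\{\boldsymbol z:|z_j-y_j|\le\varepsilon w_j\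 \forall j\}$, $\varepsilon>0$, have positive measure, $f(\boldsymbol y)$ is the limit as $\varepsilon\downarrow0$ of the $\boldsymbol\gamma$-averages of $f$ over these boxes. (For $J<\infty$ this holds whenever $f$ is continuous.) For $\boldsymbol\nu\in\mathcal F$ let $b_{\boldsymbol\nu}=\sum_{|\boldsymbol\mu|_\infty\le r}\binom{\boldsymbol\nu}{\boldsymbol\mu}\boldsymbol\tau^{2\boldsymbol\mu}$, with $\binom{\boldsymbol\nu}{\boldsymbol\mu}=\prod_j\binom{\nu_j}{\mu_j}$. **Theorem 3.5.** There is a constant $C$, depending only on $q$, $(\tau_j)_{j\ge 1}$ and $r$, such that for every $J$ and every $N\ge0$: there is a set $\Lambda_N\subset\mathcal F$ of $N$ indices with the $N$ smallest values of $b_{\boldsymbol\nu}$ (i.e. $|\Lambda_N|=N$ and $b_{\boldsymbol\nu}\le b_{\boldsymbol\mu}$ for $\boldsymbol\nu\in\Lambda_N$, $\boldsymbol\mu\notin\Lambda_N$); every such $\Lambda_N$ is admissible; and for every sequence of rules and every $f$ as above $$\Big\|\int_Y f\,d\boldsymbol\gamma-\mathcal Q_{\Lambda_N}(f)\Big\|_{\mathcal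 S}\le C\,B(f)^{1/2}\,(N+1)^{-s},\qquad s=\frac1q-\frac12 .$$ In particular the constant $C\,B(f)^{1/2}$ depends neither on $N$ nor, given $B(f)$, on the dimension $J$. -/

import Mathlib

open MeasureTheory ProbabilityTheory Filter Topology
open scoped ContDiff Polynomial

namespace SparseQuad

noncomputable section

/-- The index set of the coordinates of `ℝ^J`, for `1 ≤ J < ∞` or `J = ∞` (numbered from `0`). -/
abbrev Coord (J : ℕ∞) : Type := {j : ℕ // (j : ℕ∞) < J}

/-! ### Univariate quadrature -/

/-- A sequence of univariate quadrature rules, `Q_l(g) = ∑ k < m l, w_k^l g(y_k^l)`, with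
`m 0 = 1` and `m l < m (l + 1)`; the only node at level `0` is the origin. -/
structure UnivQuad where
  m : ℕ → ℕ
  node : (l : ℕ) → Fin (m l) → ℝ
  weight : (l : ℕ) → Fin (m l) → ℝ
  m_zero : m 0 = 1
  m_lt : ∀ l, m l < m (l + 1)
  node_zero : ∀ k, node 0 k = 0

/-- The value `Q_l(g)` for a real function `g`. -/
def UnivQuad.apply (Q : UnivQuad) (l : ℕ) (g : ℝ → ℝ) : ℝ :=
  ∑ k : Fin (Q.m l), Q.weight l k * g (Q.node l k)

/-- The Hermite polynomials, orthonormal with respect to the standard Gaussian measure: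
`H_n = (-1)^n (n!)^{-1/2} ρ^{(n)} / ρ`. Mathlib's `Polynomial.hermite` is the monic
probabilists' polynomial `(-1)^n ρ^{(n)} / ρ`. -/
def hermiteFun (n : ℕ) (y : ℝ) : ℝ :=
  Polynomial.aeval y (Polynomial.hermite n) / √(n.factorial : ℝ)

/-- Exactness at level `l` on polynomials of degree at most `l`, and the bound by `2` on the
orthonormal Hermite polynomials of higher degree. -/
structure UnivQuad.ExactAndBounded (Q : UnivQuad) : Prop where
  exact : ∀ (l : ℕ) (p : ℝ[X]), p.natDegree ≤ l →
    Q.apply l (fun y => p.eval y) = ∫ y, p.eval y ∂(gaussianReal 0 1)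
  bounded : ∀ l n : ℕ, l < n → |Q.apply l (hermiteFun n)| < 2

/-! ### Tensor-product and sparse quadrature -/

section Quadrature

variable {ι : Type*} {S : Type*} [NormedAddCommGroup S] [NormedSpace ℝ S]

open Classical in
/-- The point with coordinates `y_{k_j}^{l_j}` for `j ∈ s` and `0` for `j ∉ s`. -/
def gridPoint (Q : UnivQuad) (s : Finset ι) (l : ι → ℕ) (k : (j : s) → Fin (Q.m (l j))) : ι → ℝ :=
  fun i => if h : i ∈ s then Q.node (l i) (k ⟨i, h⟩) else 0

open Classical in
/-- The tensor product `⨂_{j ∈ s} Q_{l_j}` applied to `f`; the coordinates outside `s` are set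
to `0`. -/
def tensorQuad (Q : UnivQuad) (s : Finset ι) (l : ι → ℕ) (f : (ι → ℝ) → S) : S :=
  ∑ k : (j : s) → Fin (Q.m (l j)), (∏ j : s, Q.weight (l j) (k j)) • f (gridPoint Q s l k)

open Classical in
/-- The difference quadrature `⨂_{j ∈ supp ν} (Q_{ν_j} - Q_{ν_j - 1})` applied to `f`, multiplied
out: `A` is the set of coordinates in which the second term is taken. -/
def diffQuad (Q : UnivQuad) (ν : ι →₀ ℕ) (f : (ι → ℝ) → S) : S :=
  ∑ A ∈ ν.support.powerset,
    (-1 : ℝ) ^ A.card • tensorQuad Q ν.support (fun j => if j ∈ A then ν j - 1 else ν j) f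

/-- The sparse quadrature `Q_Λ(f)`. -/
def sparseQuad (Q : UnivQuad) (Λ : Finset (ι →₀ ℕ)) (f : (ι → ℝ) → S) : S :=
  ∑ ν ∈ Λ, diffQuad Q ν f

end Quadrature

/-! ### Index sets -/

section Index

variable {ι : Type*}

/-- Admissible, i.e. downward closed for the coordinatewise order. -/
def Admissible (Λ : Finset (ι →₀ ℕ)) : Prop :=
  ∀ ν ∈ Λ, ∀ μ : ι →₀ ℕ, (∀ j, μ j ≤ ν j) → μ ∈ Λ

/-- The multi-indices `μ` with `|μ|_∞ ≤ r`. -/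
abbrev BddIndex (ι : Type*) (r : ℕ) : Type _ := {μ : ι →₀ ℕ // ∀ j, μ j ≤ r}

/-- `b_ν = ∑_{|μ|_∞ ≤ r} binom(ν, μ) τ^{2μ}`; only the finitely many terms with `μ ≤ ν` are
nonzero, and the factors with `μ_j = 0` are `1`. -/
def bWeight (τ : ι → ℝ) (r : ℕ) (ν : ι →₀ ℕ) : ℝ :=
  ∑' μ : BddIndex ι r, μ.1.prod fun j k => ((ν j).choose k : ℝ) * τ j ^ (2 * k)

/-- `Λ` consists of `N` indices with the `N` smallest values of `b`. -/
def IsNSmallest (b : (ι →₀ ℕ) → ℝ) (N : ℕ) (Λ : Finset (ι →₀ ℕ)) : Prop :=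
  Λ.card = N ∧ ∀ ν ∈ Λ, ∀ μ, μ ∉ Λ → b ν ≤ b μ

end Index

/-! ### The Gaussian measure and weak mixed derivatives -/

section Analysis

variable {ι : Type*} {S : Type*} [NormedAddCommGroup S] [NormedSpace ℝ S]

/-- The product of standard Gaussian measures on `ℝ^ι`. -/
def gaussProd (ι : Type*) : Measure (ι → ℝ) := Measure.infinitePi fun _ => gaussianReal 0 1

/-- Test functions: smooth compactly supported functions of finitely many coordinates. -/
def IsTestFun (φ : (ι → ℝ) → ℝ) : Prop :=
  ∃ (s : Finset ι) (ψ : (s → ℝ) → ℝ), ContDiff ℝ ∞ ψ ∧ HasCompactSupport ψ ∧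
    ∀ y, φ y = ψ fun i => y i

open Classical in
/-- `v` is the weak partial derivative of `u` in the coordinate `j`. Integration by parts is with
respect to the Gaussian measure, for which the adjoint of `∂_j` is `φ ↦ y_j φ - ∂_j φ`. -/
def IsWeakPartial (j : ι) (u v : (ι → ℝ) → S) : Prop :=
  ∀ φ, IsTestFun φ →
    ∫ y, (y j * φ y - lineDeriv ℝ φ y (Pi.single j 1)) • u y ∂(gaussProd ι) =
      ∫ y, φ y • v y ∂(gaussProd ι)

/-- `∑_{|μ|_∞ ≤ r} τ^{2μ} / μ! ∫ ‖D^μ‖²`, term by term. -/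
def energyTerm (τ : ι → ℝ) (r : ℕ) (D : (ι →₀ ℕ) → (ι → ℝ) → S) (μ : BddIndex ι r) : ℝ :=
  (μ.1.prod fun j k => τ j ^ (2 * k) / (k.factorial : ℝ)) * ∫ y, ‖D μ.1 y‖ ^ 2 ∂(gaussProd ι)

/-- `D μ = ∂^μ f` (weakly) is in `L²` for all `|μ|_∞ ≤ r`, and the weighted sum of the squared
norms is finite. -/
structure HasMixedDerivs (τ : ι → ℝ) (r : ℕ) (f : (ι → ℝ) → S)
    (D : (ι →₀ ℕ) → (ι → ℝ) → S) : Prop where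
  zero : D 0 = f
  memLp : ∀ μ : ι →₀ ℕ, (∀ i, μ i ≤ r) → MemLp (D μ) 2 (gaussProd ι)
  succ : ∀ (μ : ι →₀ ℕ) (j : ι), (∀ i, (μ + Finsupp.single j 1 : ι →₀ ℕ) i ≤ r) →
    IsWeakPartial j (D μ) (D (μ + Finsupp.single j 1))
  summable : Summable (energyTerm τ r D)

/-- The weighted sum of the squared norms of the mixed derivatives. -/
def energy (τ : ι → ℝ) (r : ℕ) (D : (ι →₀ ℕ) → (ι → ℝ) → S) : ℝ :=
  ∑' μ : BddIndex ι r, energyTerm τ r D μ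

/-- The box with centre `y` and half-widths `a j`. -/
def box (y a : ι → ℝ) : Set (ι → ℝ) := {z | ∀ j, |z j - y j| ≤ a j}

/-- The value `f y` is the limit of the Gaussian averages of `f` over the boxes
`{z | ∀ j, |z_j - y_j| ≤ ε w_j}` as `ε ↓ 0`, for some weights `w_j > 0` for which these boxes have
positive measure. It ties the value of `f` at the single point `y` to the class of `f` modulo null
sets; it holds wherever `f` is continuous for a norm `sup_j |z_j| / w_j`. -/
def IsAverageValueAt (f : (ι → ℝ) → S) (y : ι → ℝ) : Prop :=
  ∃ w : ι → ℝ, (∀ j, 0 < w j) ∧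
    (∀ ε : ℝ, 0 < ε → gaussProd ι (box y fun j => ε * w j) ≠ 0) ∧
    Tendsto (fun ε : ℝ => ⨍ z in box y (fun j => ε * w j), f z ∂(gaussProd ι))
      (𝓝[>] 0) (𝓝 (f y))

end Analysis

end

end SparseQuad

namespace SparseQuad

noncomputable section

/-! ### Hermite polynomials in one variable -/

/-! Composing with a norming functional makes `f` scalar, with Hermite coefficients `x_ν`. The error
becomes `∑ x_ν e_ν`, where `e_ν` is the quadrature error on the tensor Hermite polynomial `H_ν`, and
it is estimated by a Cauchy-Schwarz inequality with weights `b_ν`.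

Smoothness controls `x`. Integration by parts turns a derivative into an index shift: the `ν`-th
coefficient of `∂^μ f` is the square root of a falling factorial times `x_{ν+μ}`. Bessel's
inequality for every derivative, summed against `τ^{2μ}/μ!`, gives `∑ b_ν x_ν² ≤ B(f)`
(`HasMixedDerivs.sum_bWeight_mul_sq_le`).

Exactness controls `e`. On an admissible `Λ` the differences telescope, so `e_ν = 0` for `ν ∈ Λ`
(`sparseQuad_hermiteProd_of_mem`). For all other `ν` one has `|e_ν| ≤ p_ν := ∏ (1 + 4 ν_j)`
(`abs_integral_sub_sparseQuad_hermiteProd_le`).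

The rate comes from the weights. Since `b_ν` is a product of univariate factors of size at least `c
n^r τ_j²`, the sum of `p_ν² b_ν^{-q/2}` is at most some `A` that does not depend on `J`
(`exists_sum_majorant_le`). Hence `b_ν^{-q/2} ≤ A/(N+1)` off `Λ_N`, and writing `1/b =
(b^{-q/2})^{2/q-1} b^{-q/2}` bounds the tail of `∑ p_ν²/b_ν` by `A (A/(N+1))^{2/q-1}`, whose square
root is the asserted rate.

The delicate point is that quadrature uses point values while Hermite series live in `L²`. The
indicator of a box satisfies Parseval's identity, which follows from completeness in one variable
and a limit of finite products, so box averages of `f` expand termwise (`hasSum_average_box`).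
Averages of `H_ν` over shrinking boxes are at most a constant to the power `|supp ν|`, up to a
factor independent of `ν`; the decay of `x_ν` absorbs this, and dominated convergence yields the
pointwise expansion (`hasSum_hermiteProd_of_isAverageValueAt`). -/

theorem derivative_hermite_succ (n : ℕ) :
    Polynomial.derivative (Polynomial.hermite (n + 1)) = (n + 1 : ℤ[X]) * Polynomial.hermite n := by
  induction n with
  | zero => simp [Polynomial.hermite_succ]
  | succ n ih =>
    have h := Polynomial.hermite_succ n
    rw [Polynomial.hermite_succ (n + 1), ih]
    have h1 : Polynomial.derivative ((n + 1 : ℤ[X]) * Polynomial.hermite n) =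
        (n + 1 : ℤ[X]) * Polynomial.derivative (Polynomial.hermite n) := by
      have : ((n : ℤ[X]) + 1) = ((n + 1 : ℕ) : ℤ[X]) := by push_cast; ring
      rw [this, Polynomial.derivative_natCast_mul]
    simp only [Polynomial.derivative_sub, Polynomial.derivative_mul, Polynomial.derivative_X]
    rw [← Polynomial.derivative_mul, ih, h1, h]
    push_cast
    ring

/-- The real monic Hermite polynomial. -/
def hermiteReal (n : ℕ) : ℝ[X] := (Polynomial.hermite n).map (Int.castRingHom ℝ)

theorem hermiteReal_succ (n : ℕ) :
    hermiteReal (n + 1) =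
      Polynomial.X * hermiteReal n - Polynomial.derivative (hermiteReal n) := by
  simp [hermiteReal, Polynomial.hermite_succ, Polynomial.derivative_map]

theorem derivative_hermiteReal_succ (n : ℕ) :
    Polynomial.derivative (hermiteReal (n + 1)) = Polynomial.C (n + 1 : ℝ) * hermiteReal n := by
  rw [hermiteReal, Polynomial.derivative_map, derivative_hermite_succ]
  simp [hermiteReal]

theorem hermiteReal_zero : hermiteReal 0 = 1 := by simp [hermiteReal]

theorem hermiteFun_eq_eval (n : ℕ) (y : ℝ) :
    hermiteFun n y = (hermiteReal n).eval y / √(n.factorial : ℝ) := by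
  rw [hermiteFun, hermiteReal, Polynomial.eval_map, Polynomial.aeval_def]
  rfl

/-- The orthonormal Hermite polynomial as an element of `ℝ[X]`. -/
def hermitePoly (n : ℕ) : ℝ[X] := Polynomial.C (√(n.factorial : ℝ))⁻¹ * hermiteReal n

theorem hermitePoly_eval (n : ℕ) (y : ℝ) : (hermitePoly n).eval y = hermiteFun n y := by
  rw [hermiteFun_eq_eval, hermitePoly, Polynomial.eval_mul, Polynomial.eval_C, div_eq_inv_mul]

theorem hermiteFun_eq (n : ℕ) : hermiteFun n = fun y => (hermitePoly n).eval y :=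
  funext fun y => (hermitePoly_eval n y).symm

theorem natDegree_hermitePoly_le (n : ℕ) : (hermitePoly n).natDegree ≤ n := by
  refine (Polynomial.natDegree_C_mul_le _ _).trans ?_
  refine (Polynomial.natDegree_map_le).trans ?_
  rw [Polynomial.natDegree_hermite]

@[simp] theorem hermiteFun_zero (y : ℝ) : hermiteFun 0 y = 1 := by simp [hermiteFun]

theorem contDiff_eval (p : ℝ[X]) : ContDiff ℝ ∞ fun x => p.eval x := by
  simpa [Polynomial.aeval_def, Polynomial.eval₂_eq_eval_map] using p.contDiff_aeval (𝕜 := ℝ) ∞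

@[fun_prop]
theorem contDiff_hermiteFun (n : ℕ) : ContDiff ℝ ∞ (hermiteFun n) := by
  rw [hermiteFun_eq]
  exact contDiff_eval _

@[fun_prop]
theorem continuous_hermiteFun (n : ℕ) : Continuous (hermiteFun n) :=
  (contDiff_hermiteFun n).continuous

theorem sqrt_factorial_succ (n : ℕ) :
    √((n + 1).factorial : ℝ) = √(n + 1 : ℝ) * √(n.factorial : ℝ) := by
  rw [Nat.factorial_succ, Nat.cast_mul, Real.sqrt_mul (by positivity)]
  push_cast; rfl

theorem sqrt_factorial_pos (n : ℕ) : 0 < √(n.factorial : ℝ) := by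
  have := n.factorial_pos
  positivity

theorem hasDerivAt_hermiteFun_succ (n : ℕ) (y : ℝ) :
    HasDerivAt (hermiteFun (n + 1)) (√(n + 1 : ℝ) * hermiteFun n y) y := by
  have h := ((hermiteReal (n + 1)).hasDerivAt y).div_const (√((n + 1).factorial : ℝ))
  rw [derivative_hermiteReal_succ] at h
  have e : hermiteFun (n + 1) =
      fun x => (hermiteReal (n + 1)).eval x / √((n + 1).factorial : ℝ) :=
    funext fun x => hermiteFun_eq_eval _ _
  rw [e]
  refine h.congr_deriv ?_
  rw [hermiteFun_eq_eval, sqrt_factorial_succ, Polynomial.eval_mul, Polynomial.eval_C]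
  have h1 := sqrt_factorial_pos n
  have h2 : (0 : ℝ) < n + 1 := by positivity
  have h3 : 0 < √(n + 1 : ℝ) := by positivity
  field_simp
  rw [Real.sq_sqrt h2.le]
  ring

theorem hasDerivAt_hermiteFun (n : ℕ) (y : ℝ) :
    HasDerivAt (hermiteFun n) (y * hermiteFun n y - √(n + 1 : ℝ) * hermiteFun (n + 1) y) y := by
  have h := ((hermiteReal n).hasDerivAt y).div_const (√(n.factorial : ℝ))
  have e : hermiteFun n = fun x => (hermiteReal n).eval x / √(n.factorial : ℝ) :=
    funext fun x => hermiteFun_eq_eval _ _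
  have e2 := congrArg (Polynomial.eval y) (hermiteReal_succ n)
  rw [Polynomial.eval_sub, Polynomial.eval_mul, Polynomial.eval_X] at e2
  rw [hermiteFun_eq_eval (n + 1), e2, sqrt_factorial_succ, e]
  refine h.congr_deriv ?_
  have h1 := sqrt_factorial_pos n
  have h3 : 0 < √(n + 1 : ℝ) := by positivity
  field_simp
  ring

/-- The lowering and the raising formula both compute the derivative of `H_{n+1}`; equating them
gives the three-term recurrence. -/
theorem hermiteFun_recurrence (n : ℕ) (y : ℝ) :
    √(n + 2 : ℝ) * hermiteFun (n + 2) y =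
      y * hermiteFun (n + 1) y - √(n + 1 : ℝ) * hermiteFun n y := by
  have h := (hasDerivAt_hermiteFun_succ n y).unique (hasDerivAt_hermiteFun (n + 1) y)
  push_cast at h
  rw [show (n : ℝ) + 1 + 1 = n + 2 by ring] at h
  linarith

theorem mul_hermiteFun_succ (n : ℕ) (y : ℝ) :
    y * hermiteFun (n + 1) y =
      √(n + 2 : ℝ) * hermiteFun (n + 2) y + √(n + 1 : ℝ) * hermiteFun n y := by
  linarith [hermiteFun_recurrence n y]

theorem hermiteFun_one (y : ℝ) : hermiteFun 1 y = y := by simp [hermiteFun]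

/-- At the origin the recurrence loses its middle term, so `H_{n+2}(0)² ≤ H_n(0)²` and the sum of
two neighbours cannot increase. Neighbours are taken together because this is the quantity that is
monotone in `|y|` after multiplication by `e^{-y²}`. -/
theorem sq_hermiteFun_zero_add_le (n : ℕ) :
    hermiteFun (n + 1) 0 ^ 2 + hermiteFun n 0 ^ 2 ≤ 1 := by
  have key : ∀ n, hermiteFun (n + 2) 0 ^ 2 ≤ hermiteFun n 0 ^ 2 := by
    intro n
    have h := hermiteFun_recurrence n 0
    have h2 : (n + 2 : ℝ) * hermiteFun (n + 2) 0 ^ 2 = (n + 1 : ℝ) * hermiteFun n 0 ^ 2 := by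
      have := congrArg (· ^ 2) h
      simp only [zero_mul, zero_sub, neg_sq, mul_pow] at this
      rwa [Real.sq_sqrt (by positivity), Real.sq_sqrt (by positivity)] at this
    have hn : (0 : ℝ) ≤ n := by positivity
    nlinarith [sq_nonneg (hermiteFun (n + 2) 0), sq_nonneg (hermiteFun n 0)]
  induction n with
  | zero => simp [hermiteFun_one]
  | succ n ih => linarith [key n]

theorem abs_hermiteFun_zero_le (n : ℕ) : |hermiteFun n 0| ≤ 1 := by
  have h := sq_hermiteFun_zero_add_le n
  rw [← sq_le_one_iff_abs_le_one]
  nlinarith [sq_nonneg (hermiteFun (n + 1) 0)]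

/-- The quantity `(H_{n+1}² + H_n²) e^{-y²}` has derivative `-2 y H_{n+1}² e^{-y²}`. -/
theorem sq_hermiteFun_add_le (n : ℕ) (y : ℝ) :
    hermiteFun (n + 1) y ^ 2 + hermiteFun n y ^ 2 ≤ Real.exp (y ^ 2) := by
  set G : ℝ → ℝ := fun x =>
    (hermiteFun (n + 1) x ^ 2 + hermiteFun n x ^ 2) * Real.exp (-x ^ 2) with hG
  have hd : ∀ x, HasDerivAt G (-2 * x * hermiteFun (n + 1) x ^ 2 * Real.exp (-x ^ 2)) x := by
    intro x
    -- Lowering for `H_{n+1}` and raising for `H_n`: the cross terms `√(n+1) H_n H_{n+1}` cancel.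
    have h1 := ((hasDerivAt_hermiteFun_succ n x).pow 2).add ((hasDerivAt_hermiteFun n x).pow 2)
    have h2 : HasDerivAt (fun x : ℝ => Real.exp (-x ^ 2)) (Real.exp (-x ^ 2) * (-(2 * x))) x := by
      have := ((hasDerivAt_pow 2 x).neg).exp
      simpa using this
    convert! h1.mul h2 using 1
    simp
    ring
  have hc : Continuous G := by
    have h1 := continuous_hermiteFun n
    have h2 := continuous_hermiteFun (n + 1)
    fun_prop
  have hG0 : G 0 ≤ 1 := by simpa [hG] using sq_hermiteFun_zero_add_le n
  have hGy : G y ≤ 1 := by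
    rcases le_total 0 y with hy | hy
    · have : AntitoneOn G (Set.Ici 0) := by
        refine antitoneOn_of_deriv_nonpos (convex_Ici 0) hc.continuousOn
          (fun x _ => (hd x).differentiableAt.differentiableWithinAt) fun x hx => ?_
        rw [interior_Ici] at hx
        rw [(hd x).deriv]
        have : (0 : ℝ) < x := hx
        have h0 : 0 ≤ 2 * x * hermiteFun (n + 1) x ^ 2 * Real.exp (-x ^ 2) := by positivity
        linarith
      exact (this (Set.mem_Ici.2 le_rfl) hy hy).trans hG0
    · have : MonotoneOn G (Set.Iic 0) := by
        refine monotoneOn_of_deriv_nonneg (convex_Iic 0) hc.continuousOn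
          (fun x _ => (hd x).differentiableAt.differentiableWithinAt) fun x hx => ?_
        rw [interior_Iic] at hx
        rw [(hd x).deriv]
        have hx' : (0 : ℝ) < -x := neg_pos.2 hx
        have h0 : 0 ≤ 2 * (-x) * hermiteFun (n + 1) x ^ 2 * Real.exp (-x ^ 2) := by positivity
        linarith
      exact (this hy (Set.mem_Iic.2 le_rfl) hy).trans hG0
  simp only [hG, Real.exp_neg] at hGy
  rwa [← div_eq_mul_inv, div_le_one (Real.exp_pos _)] at hGy

/-- The bound is uniform in the degree, which makes dominated convergence over all multi-indices
possible. -/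
theorem abs_hermiteFun_le (n : ℕ) (y : ℝ) : |hermiteFun n y| ≤ Real.exp (y ^ 2 / 2) := by
  have h := sq_hermiteFun_add_le n y
  refine abs_le_of_sq_le_sq ?_ (Real.exp_pos _).le
  rw [← Real.exp_nat_mul]
  push_cast
  rw [mul_div_cancel₀ _ (two_ne_zero)]
  nlinarith [sq_nonneg (hermiteFun (n + 1) y)]

/-! ### Orthonormality -/

/-- The standard Gaussian measure on the line. -/
abbrev stdGauss : Measure ℝ := gaussianReal 0 1

theorem integrable_eval_stdGauss (p : ℝ[X]) : Integrable (fun x => p.eval x) stdGauss := by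
  simp only [Polynomial.eval_eq_sum_range]
  refine integrable_finsetSum _ fun n _ => Integrable.const_mul ?_ _
  have h := (memLp_id_gaussianReal (μ := 0) (v := 1) n).integrable_norm_pow' (p := n)
  refine h.mono (by fun_prop) ?_
  exact ae_of_all _ fun x => by simp

theorem memLp_eval_stdGauss (p : ℝ[X]) : MemLp (fun x => p.eval x) 2 stdGauss := by
  rw [memLp_two_iff_integrable_sq (by fun_prop)]
  exact (integrable_eval_stdGauss (p ^ 2)).congr (ae_of_all _ fun x => by simp)

theorem memLp_hermiteFun (n : ℕ) : MemLp (hermiteFun n) 2 stdGauss := by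
  rw [hermiteFun_eq]
  exact memLp_eval_stdGauss _

theorem hasDerivAt_gaussianPDFReal (x : ℝ) :
    HasDerivAt (gaussianPDFReal 0 1) (-x * gaussianPDFReal 0 1 x) x := by
  simp only [gaussianPDFReal_def]
  have h : HasDerivAt (fun x : ℝ => -(x - 0) ^ 2 / (2 * ((1 : NNReal) : ℝ))) (-x) x := by
    have := (((hasDerivAt_id x).sub_const 0).pow 2).neg.div_const (2 * ((1 : NNReal) : ℝ))
    refine this.congr_deriv ?_
    simp
    ring
  refine ((h.exp).const_mul _).congr_deriv ?_
  ring

theorem integrable_gaussianPDFReal_mul_eval (p : ℝ[X]) :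
    Integrable fun x => gaussianPDFReal 0 1 x * p.eval x := by
  have h := integrable_eval_stdGauss p
  rw [stdGauss, gaussianReal_of_var_ne_zero _ one_ne_zero, integrable_withDensity_iff_integrable_smul'
    (measurable_gaussianPDF _ _) (ae_of_all _ fun _ => gaussianPDF_lt_top)] at h
  simpa [toReal_gaussianPDF] using h

/-- Integration by parts for polynomials against the standard Gaussian measure. -/
theorem integral_mul_eval_stdGauss (p : ℝ[X]) :
    ∫ x, x * p.eval x ∂stdGauss = ∫ x, (Polynomial.derivative p).eval x ∂stdGauss := by
  have hX : Integrable (fun x => x * p.eval x) stdGauss := by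
    exact (integrable_eval_stdGauss (Polynomial.X * p)).congr (ae_of_all _ fun x => by simp)
  have hD := integrable_eval_stdGauss (Polynomial.derivative p)
  rw [eq_comm, ← sub_eq_zero, ← integral_sub hD hX, integral_gaussianReal_eq_integral_smul one_ne_zero]
  refine integral_eq_zero_of_hasDerivAt_of_integrable
    (f := fun x => gaussianPDFReal 0 1 x * p.eval x) (fun x => ?_) ?_
    (integrable_gaussianPDFReal_mul_eval p)
  · refine ((hasDerivAt_gaussianPDFReal x).mul (p.hasDerivAt x)).congr_deriv ?_
    simp only [smul_eq_mul]
    ring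
  · have := integrable_gaussianPDFReal_mul_eval (Polynomial.derivative p - Polynomial.X * p)
    simpa using this

theorem integral_hermiteReal_succ_mul (n : ℕ) (p : ℝ[X]) :
    ∫ x, (hermiteReal (n + 1)).eval x * p.eval x ∂stdGauss =
      ∫ x, (hermiteReal n).eval x * (Polynomial.derivative p).eval x ∂stdGauss := by
  have h := integral_mul_eval_stdGauss (hermiteReal n * p)
  have i1 := integrable_eval_stdGauss (Polynomial.X * (hermiteReal n * p))
  have i2 := integrable_eval_stdGauss (Polynomial.derivative (hermiteReal n) * p)
  have i3 := integrable_eval_stdGauss (hermiteReal n * Polynomial.derivative p)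
  simp only [Polynomial.eval_mul, Polynomial.eval_X] at i1 i2 i3 h
  have e1 : ∀ x, (hermiteReal (n + 1)).eval x * p.eval x =
      x * ((hermiteReal n).eval x * p.eval x) -
        (Polynomial.derivative (hermiteReal n)).eval x * p.eval x := by
    intro x
    rw [hermiteReal_succ]
    simp
    ring
  simp only [e1]
  rw [integral_sub i1 i2, h]
  simp only [Polynomial.derivative_mul, Polynomial.eval_add, Polynomial.eval_mul]
  rw [integral_add i2 i3]
  ring

theorem integral_hermiteReal_mul (n m : ℕ) :
    ∫ x, (hermiteReal n).eval x * (hermiteReal m).eval x ∂stdGauss =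
      if n = m then (n.factorial : ℝ) else 0 := by
  induction n generalizing m with
  | zero =>
    cases m with
    | zero => simp [hermiteReal_zero]
    | succ m =>
      have := integral_hermiteReal_succ_mul m 1
      simp only [hermiteReal_zero]
      simp only [Polynomial.eval_one, mul_one, Polynomial.derivative_one, Polynomial.eval_zero,
        mul_zero, integral_zero] at this
      simpa using this
  | succ n ih =>
    rw [integral_hermiteReal_succ_mul]
    cases m with
    | zero => simp [hermiteReal_zero]
    | succ m =>
      have e : ∀ x, (hermiteReal n).eval x *
          (Polynomial.derivative (hermiteReal (m + 1))).eval x =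
          (m + 1 : ℝ) * ((hermiteReal n).eval x * (hermiteReal m).eval x) := by
        intro x
        rw [derivative_hermiteReal_succ, Polynomial.eval_mul, Polynomial.eval_C]
        ring
      simp only [e]
      rw [integral_const_mul, ih]
      by_cases h : n = m
      · subst h
        simp [Nat.factorial_succ]
      · simp [h]

theorem integral_hermiteFun_mul (n m : ℕ) :
    ∫ x, hermiteFun n x * hermiteFun m x ∂stdGauss = if n = m then 1 else 0 := by
  have e : ∀ x, hermiteFun n x * hermiteFun m x = (√(n.factorial : ℝ))⁻¹ * (√(m.factorial : ℝ))⁻¹ *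
      ((hermiteReal n).eval x * (hermiteReal m).eval x) := by
    intro x
    rw [hermiteFun_eq_eval, hermiteFun_eq_eval]
    ring
  simp only [e]
  rw [integral_const_mul, integral_hermiteReal_mul]
  split_ifs with h
  · subst h
    have h1 := sqrt_factorial_pos n
    rw [← mul_inv, Real.mul_self_sqrt (by positivity), inv_mul_cancel₀ (by positivity)]
  · simp

theorem integral_hermiteFun (n : ℕ) :
    ∫ x, hermiteFun n x ∂stdGauss = if n = 0 then 1 else 0 := by
  simpa using integral_hermiteFun_mul n 0

/-! ### Completeness -/

theorem integrable_exp_abs_mul_stdGauss (t : ℝ) :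
    Integrable (fun x => Real.exp (|t * x|)) stdGauss := by
  have h1 := integrable_exp_mul_gaussianReal (μ := 0) (v := 1) t
  have h2 := integrable_exp_mul_gaussianReal (μ := 0) (v := 1) (-t)
  refine (h1.add h2).mono (by fun_prop) (ae_of_all _ fun x => ?_)
  simp only [Pi.add_apply, Real.norm_eq_abs, Real.abs_exp, neg_mul]
  refine le_trans ?_ (le_abs_self _)
  rcases abs_choice (t * x) with h | h <;> rw [h]
  · linarith [Real.exp_pos (-(t * x))]
  · linarith [Real.exp_pos (t * x)]

/-- Multiplication by `x` maps each `H_n` into the span of its neighbours, so by induction on `k`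
all `x^k H_n` are orthogonal to `u`; the statement must be carried for every `n` at once. -/
theorem integral_pow_mul_eq_zero {u : ℝ → ℝ} (hu : MemLp u 2 stdGauss)
    (h : ∀ n, ∫ x, hermiteFun n x * u x ∂stdGauss = 0) (k : ℕ) :
    ∫ x, x ^ k * u x ∂stdGauss = 0 := by
  have hint : ∀ p : ℝ[X], Integrable (fun x => p.eval x * u x) stdGauss := fun p =>
    (memLp_eval_stdGauss p).integrable_mul hu
  have key : ∀ k n, ∫ x, x ^ k * (hermiteFun n x * u x) ∂stdGauss = 0 := by
    intro k
    induction k with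
    | zero => intro n; simpa using h n
    | succ k ih =>
      intro n
      cases n with
      | zero =>
        have := ih 1
        simpa [hermiteFun_one, pow_succ, mul_assoc] using this
      | succ n =>
        have e : ∀ x, x ^ (k + 1) * (hermiteFun (n + 1) x * u x) =
            √(n + 2 : ℝ) * (x ^ k * (hermiteFun (n + 2) x * u x)) +
              √(n + 1 : ℝ) * (x ^ k * (hermiteFun n x * u x)) := by
          intro x
          have := mul_hermiteFun_succ n x
          rw [show x ^ (k + 1) * (hermiteFun (n + 1) x * u x) =
            x ^ k * u x * (x * hermiteFun (n + 1) x) by ring, this]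
          ring
        have hi : ∀ m, Integrable (fun x => x ^ k * (hermiteFun m x * u x)) stdGauss := by
          intro m
          have := hint (Polynomial.X ^ k * hermitePoly m)
          simpa [hermitePoly_eval, mul_assoc] using this
        simp only [e]
        rw [integral_add ((hi _).const_mul _) ((hi _).const_mul _), integral_const_mul,
          integral_const_mul, ih, ih]
        simp
  simpa using key k 0

/-- All moments of `u` vanish, and the exponential series may be integrated termwise because it is
dominated by `e^{|tx|} |u|`, a product of two `L²` functions. -/
theorem integral_cexp_mul_eq_zero {u : ℝ → ℝ} (hu : MemLp u 2 stdGauss)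
    (h : ∀ n, ∫ x, hermiteFun n x * u x ∂stdGauss = 0) (t : ℝ) :
    ∫ x, Complex.exp (t * x * Complex.I) * (u x : ℂ) ∂stdGauss = 0 := by
  have hexp : MemLp (fun x => Real.exp |t * x|) 2 stdGauss := by
    rw [memLp_two_iff_integrable_sq (by fun_prop)]
    refine (integrable_exp_abs_mul_stdGauss (2 * t)).congr (ae_of_all _ fun x => ?_)
    simp only
    rw [← Real.exp_nat_mul, mul_assoc, abs_mul 2]
    norm_num
  have hsum : ∀ x : ℝ, HasSum (fun n : ℕ => |t * x| ^ n / (n.factorial : ℝ) * |u x|)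
      (Real.exp |t * x| * |u x|) := by
    intro x
    refine HasSum.mul_right _ ?_
    rw [Real.exp_eq_exp_ℝ]
    exact NormedSpace.expSeries_div_hasSum_exp |t * x|
  have hs := hasSum_integral_of_dominated_convergence (μ := stdGauss)
    (F := fun (n : ℕ) (x : ℝ) => (t * x * Complex.I : ℂ) ^ n / (n.factorial : ℂ) * (u x : ℂ))
    (f := fun x => Complex.exp (t * x * Complex.I) * (u x : ℂ))
    (fun (n : ℕ) x => |t * x| ^ n / (n.factorial : ℝ) * |u x|) ?_ ?_ ?_ ?_ ?_
  · refine hs.unique ?_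
    convert! hasSum_zero with n
    have e : ∀ x : ℝ, (t * x * Complex.I : ℂ) ^ n / (n.factorial : ℂ) * (u x : ℂ) =
        ((t * Complex.I : ℂ) ^ n / (n.factorial : ℂ)) * ((x ^ n * u x : ℝ) : ℂ) := by
      intro x
      push_cast
      ring
    simp only [e]
    rw [integral_const_mul, integral_complex_ofReal, integral_pow_mul_eq_zero hu h]
    simp
  · intro n
    have h1 : Continuous fun x : ℝ => (t * x * Complex.I : ℂ) ^ n / (n.factorial : ℂ) := by fun_prop
    exact h1.aestronglyMeasurable.mul
      (Complex.continuous_ofReal.comp_aestronglyMeasurable hu.aestronglyMeasurable)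
  · intro n
    refine ae_of_all _ fun x => le_of_eq ?_
    simp [abs_mul, mul_pow]
  · exact ae_of_all _ fun x => (hsum x).summable
  · have : (fun x => ∑' n : ℕ, |t * x| ^ n / (n.factorial : ℝ) * |u x|) =
        fun x => Real.exp |t * x| * |u x| := funext fun x => (hsum x).tsum_eq
    rw [this]
    exact hexp.integrable_mul hu.abs
  · refine ae_of_all _ fun x => HasSum.mul_right _ ?_
    rw [Complex.exp_eq_exp_ℂ]
    exact NormedSpace.expSeries_div_hasSum_exp _

/-- The positive and negative parts of `u` are densities of two finite measures with the same
characteristic function, hence they agree almost everywhere. -/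
theorem ae_eq_zero_of_integral_hermiteFun {u : ℝ → ℝ} (hu : MemLp u 2 stdGauss)
    (h : ∀ n, ∫ x, hermiteFun n x * u x ∂stdGauss = 0) : u =ᵐ[stdGauss] 0 := by
  wlog hm : Measurable u generalizing u
  · set v := hu.aestronglyMeasurable.mk u with hv
    have huv : u =ᵐ[stdGauss] v := hu.aestronglyMeasurable.ae_eq_mk
    refine huv.trans (this (hu.ae_eq huv) (fun n => ?_)
      hu.aestronglyMeasurable.stronglyMeasurable_mk.measurable)
    rw [← h n]
    refine integral_congr_ae ?_
    filter_upwards [huv] with x hx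
    rw [hx]
  have hui : Integrable u stdGauss := hu.integrable one_le_two
  have hfin : ∀ w : ℝ → ℝ, Integrable w stdGauss →
      ∫⁻ x, ENNReal.ofReal (w x) ∂stdGauss ≠ ⊤ := fun w hw => by
    refine ne_top_of_le_ne_top hw.2.ne (lintegral_mono fun x => ?_)
    exact Real.ofReal_le_enorm _
  have hcf : ∀ w : ℝ → ℝ, Measurable w → ∀ t : ℝ,
      charFun (stdGauss.withDensity fun x => ENNReal.ofReal (w x)) t =
        ∫ x, Complex.exp (t * x * Complex.I) * ((max (w x) 0 : ℝ) : ℂ) ∂stdGauss := by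
    intro w hw t
    rw [charFun_apply_real, integral_withDensity_eq_integral_toReal_smul (by fun_prop)
      (ae_of_all _ fun x => ENNReal.ofReal_lt_top)]
    refine integral_congr_ae (ae_of_all _ fun x => ?_)
    simp only [ENNReal.toReal_ofReal', Complex.real_smul]
    rw [mul_comm]
  have : IsFiniteMeasure (stdGauss.withDensity fun x => ENNReal.ofReal (u x)) :=
    isFiniteMeasure_withDensity (hfin u hui)
  have : IsFiniteMeasure (stdGauss.withDensity fun x => ENNReal.ofReal (-u x)) :=
    isFiniteMeasure_withDensity (hfin _ hui.neg)
  have heq : (stdGauss.withDensity fun x => ENNReal.ofReal (u x)) =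
      stdGauss.withDensity fun x => ENNReal.ofReal (-u x) := by
    refine Measure.ext_of_charFun (funext fun t => ?_)
    rw [hcf u hm, hcf (fun x => -u x) hm.neg, ← sub_eq_zero]
    have hb : ∀ w : ℝ → ℝ, Integrable w stdGauss →
        Integrable (fun x : ℝ => Complex.exp (t * x * Complex.I) * ((max (w x) 0 : ℝ) : ℂ))
          stdGauss := by
      intro w hw
      refine Integrable.bdd_mul (c := 1) (hw.pos_part.ofReal) (by fun_prop) ?_
      refine ae_of_all _ fun x => ?_
      rw [← Complex.ofReal_mul, Complex.norm_exp_ofReal_mul_I]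
    rw [← integral_sub (hb _ hui) (hb (fun x => -u x) hui.neg), ← integral_cexp_mul_eq_zero hu h t]
    refine integral_congr_ae (ae_of_all _ fun x => ?_)
    simp only
    rw [← mul_sub, ← Complex.ofReal_sub]
    congr 2
    rcases le_total 0 (u x) with hx | hx
    · rw [max_eq_left hx, max_eq_right (by linarith)]; ring
    · rw [max_eq_right hx, max_eq_left (by linarith)]; ring
  have h2 := (withDensity_eq_iff (by fun_prop) (by fun_prop) (hfin u hui)).1 heq
  filter_upwards [h2] with x hx
  rcases le_total 0 (u x) with h0 | h0
  · rw [ENNReal.ofReal_of_nonpos (by linarith : -u x ≤ 0), ENNReal.ofReal_eq_zero] at hx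
    exact le_antisymm hx h0
  · rw [ENNReal.ofReal_of_nonpos h0, eq_comm, ENNReal.ofReal_eq_zero] at hx
    exact le_antisymm h0 (neg_nonpos.1 hx)

theorem orthonormal_toLp_hermiteFun :
    Orthonormal ℝ fun n => (memLp_hermiteFun n).toLp (hermiteFun n) := by
  rw [orthonormal_iff_ite]
  intro i j
  rw [L2.inner_def, ← integral_hermiteFun_mul]
  refine integral_congr_ae ?_
  filter_upwards [(memLp_hermiteFun i).coeFn_toLp, (memLp_hermiteFun j).coeFn_toLp] with x h1 h2
  rw [h1, h2]
  simp [mul_comm]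

/-- Parseval's identity for the Hermite polynomials. -/
theorem hasSum_sq_integral_hermiteFun {u : ℝ → ℝ} (hu : MemLp u 2 stdGauss) :
    HasSum (fun n => (∫ x, hermiteFun n x * u x ∂stdGauss) ^ 2) (∫ x, u x ^ 2 ∂stdGauss) := by
  have hin : ∀ {v : ℝ → ℝ} (hv : MemLp v 2 stdGauss) (w : Lp ℝ 2 stdGauss),
      inner ℝ (hv.toLp v) w = ∫ x, v x * w x ∂stdGauss := by
    intro v hv w
    rw [L2.inner_def]
    refine integral_congr_ae ?_
    filter_upwards [hv.coeFn_toLp] with x h1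
    rw [h1]
    simp [mul_comm]
  have hbot : (Submodule.span ℝ
      (Set.range fun n => (memLp_hermiteFun n).toLp (hermiteFun n)))ᗮ = ⊥ := by
    rw [Submodule.eq_bot_iff]
    intro v hv
    rw [Submodule.mem_orthogonal] at hv
    have h0 : (v : ℝ → ℝ) =ᵐ[stdGauss] 0 := by
      refine ae_eq_zero_of_integral_hermiteFun (Lp.memLp v) fun n => ?_
      rw [← hin (memLp_hermiteFun n) v]
      exact hv _ (Submodule.subset_span ⟨n, rfl⟩)
    exact Lp.eq_zero_iff_ae_eq_zero.2 h0
  have h := (HilbertBasis.mkOfOrthogonalEqBot orthonormal_toLp_hermiteFun hbot).hasSum_inner_mul_inner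
    (hu.toLp u) (hu.toLp u)
  simp only [HilbertBasis.coe_mkOfOrthogonalEqBot] at h
  have hc : ∀ v : ℝ → ℝ, ∫ x, v x * hu.toLp u x ∂stdGauss = ∫ x, v x * u x ∂stdGauss := by
    intro v
    refine integral_congr_ae ?_
    filter_upwards [hu.coeFn_toLp] with x hx
    rw [hx]
  rw [hin hu, hc] at h
  simp only [← sq] at h
  refine h.congr_fun fun n => ?_
  rw [real_inner_comm, hin, hc, sq]

/-! ### Sums of products over finitely supported multi-indices -/

variable {ι : Type*}

theorem sum_finsupp_prod {R : Type*} [CommSemiring R] (s : Finset ι) (t : ι → Finset ℕ)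
    (f : ι → ℕ → R) :
    ∑ ν ∈ s.finsupp t, ∏ j ∈ s, f j (ν j) = ∏ j ∈ s, ∑ n ∈ t j, f j n := by
  classical
  rw [Finset.prod_sum, Finset.finsupp, Finset.sum_map]
  refine Finset.sum_congr (by congr!) fun p _ => ?_
  rw [← Finset.prod_attach s]
  refine Finset.prod_congr rfl fun j _ => ?_
  simp [Finsupp.indicator_of_mem j.2]

theorem finsupp_prod_eq_prod {R : Type*} [CommMonoid R] {f : ι → ℕ → R} (hf : ∀ j, f j 0 = 1)
    {ν : ι →₀ ℕ} {s : Finset ι} (hs : ν.support ⊆ s) : ν.prod f = ∏ j ∈ s, f j (ν j) :=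
  Finsupp.prod_of_support_subset _ hs _ fun j _ => hf j

/-! ### A Parseval criterion -/

/-- If Bessel's inequality for `p` is an equality, then `p` is the sum of its expansion in the
orthonormal family, whence inner products with `p` may be computed termwise. -/
theorem hasSum_inner_mul_inner_of_hasSum_sq {E κ : Type*} [NormedAddCommGroup E]
    [InnerProductSpace ℝ E] {v : κ → E} (hv : Orthonormal ℝ v) {p : E}
    (hp : HasSum (fun i => inner ℝ (v i) p ^ 2) (‖p‖ ^ 2)) (f : E) :
    HasSum (fun i => inner ℝ (v i) p * inner ℝ (v i) f) (inner ℝ p f) := by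
  have hsum : HasSum (fun i => inner ℝ (v i) p • v i) p := by
    rw [HasSum, tendsto_iff_norm_sub_tendsto_zero]
    have h1 : ∀ T : Finset κ, ‖∑ i ∈ T, inner ℝ (v i) p • v i - p‖ ^ 2 =
        ‖p‖ ^ 2 - ∑ i ∈ T, inner ℝ (v i) p ^ 2 := by
      intro T
      rw [norm_sub_sq_real, ← real_inner_self_eq_norm_sq, hv.inner_sum, sum_inner]
      simp only [real_inner_smul_left, conj_trivial, ← sq]
      ring
    have h2 : Tendsto (fun T : Finset κ => √(‖p‖ ^ 2 - ∑ i ∈ T, inner ℝ (v i) p ^ 2)) atTop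
        (𝓝 0) := by
      have := (tendsto_const_nhds (x := ‖p‖ ^ 2)).sub hp
      simpa using this.sqrt
    refine h2.congr fun T => ?_
    rw [← h1, Real.sqrt_sq (norm_nonneg _)]
  have h := hsum.mapL (innerSL ℝ f)
  simp only [innerSL_apply_apply, real_inner_smul_right] at h
  rw [real_inner_comm]
  refine h.congr_fun fun i => ?_
  rw [real_inner_comm f (v i)]

instance : IsProbabilityMeasure (gaussProd ι) := by
  unfold gaussProd; infer_instance

/-! ### Products of functions of one coordinate -/

section Products

variable {g : ι → ℝ → ℝ}

theorem measurable_prod_eval (hm : ∀ j, Measurable (g j)) (s : Finset ι) :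
    Measurable fun y : ι → ℝ => ∏ j ∈ s, g j (y j) :=
  Finset.measurable_fun_prod _ fun j _ => (hm j).comp (measurable_pi_apply j)

theorem integral_prod_gaussProd (hm : ∀ j, Measurable (g j)) (s : Finset ι) :
    ∫ y, ∏ j ∈ s, g j (y j) ∂(gaussProd ι) = ∏ j ∈ s, ∫ x, g j x ∂stdGauss := by
  have h := integral_restrict_infinitePi (fun _ : ι => stdGauss) (s := s)
    (f := fun y : s → ℝ => ∏ j : s, g j (y j))
    (Measurable.aestronglyMeasurable
      (Finset.measurable_fun_prod _ fun j _ => (hm j).comp (measurable_pi_apply j)))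
  rw [integral_fintype_prod_eq_prod (fun j : s => g j)] at h
  rw [← Finset.prod_coe_sort, ← h]
  refine integral_congr_ae (ae_of_all _ fun y => ?_)
  exact (Finset.prod_coe_sort s fun j => g j (y j)).symm

theorem integrable_prod_gaussProd (hg : ∀ j, Integrable (g j) stdGauss)
    (s : Finset ι) : Integrable (fun y => ∏ j ∈ s, g j (y j)) (gaussProd ι) := by
  have h : Integrable (fun y : s → ℝ => ∏ j : s, g j (y j)) (Measure.pi fun _ : s => stdGauss) :=
    Integrable.fintype_prod (f := fun j : s => g j) fun j => hg j
  rw [← Measure.infinitePi_map_restrict (fun _ : ι => stdGauss) (I := s)] at h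
  refine (h.comp_measurable (by fun_prop)).congr (ae_of_all _ fun y => ?_)
  exact Finset.prod_coe_sort s fun j => g j (y j)

theorem memLp_prod_gaussProd (hm : ∀ j, Measurable (g j)) (hg : ∀ j, MemLp (g j) 2 stdGauss)
    (s : Finset ι) : MemLp (fun y => ∏ j ∈ s, g j (y j)) 2 (gaussProd ι) := by
  rw [memLp_two_iff_integrable_sq (measurable_prod_eval hm s).aestronglyMeasurable]
  simp only [← Finset.prod_pow]
  exact integrable_prod_gaussProd (g := fun j x => g j x ^ 2) (fun j => (hg j).integrable_sq) s

end Products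

/-! ### Tensor products of Hermite polynomials -/

/-- The tensor product `H_ν(y) = ∏_j H_{ν_j}(y_j)`. -/
def hermiteProd (ν : ι →₀ ℕ) (y : ι → ℝ) : ℝ := ν.prod fun j n => hermiteFun n (y j)

theorem hermiteProd_eq_prod {ν : ι →₀ ℕ} {s : Finset ι} (hs : ν.support ⊆ s) (y : ι → ℝ) :
    hermiteProd ν y = ∏ j ∈ s, hermiteFun (ν j) (y j) :=
  finsupp_prod_eq_prod (fun _ => hermiteFun_zero _) hs

theorem measurable_hermiteFun (n : ℕ) : Measurable (hermiteFun n) :=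
  (continuous_hermiteFun n).measurable

theorem memLp_hermiteProd (ν : ι →₀ ℕ) : MemLp (hermiteProd ν) 2 (gaussProd ι) :=
  memLp_prod_gaussProd (fun j => measurable_hermiteFun (ν j)) (fun j => memLp_hermiteFun (ν j))
    ν.support

theorem integrable_hermiteProd (ν : ι →₀ ℕ) : Integrable (hermiteProd ν) (gaussProd ι) :=
  (memLp_hermiteProd ν).integrable one_le_two

open Classical in
theorem integral_hermiteProd_mul (ν μ : ι →₀ ℕ) :
    ∫ y, hermiteProd ν y * hermiteProd μ y ∂(gaussProd ι) = if ν = μ then 1 else 0 := by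
  have e : ∀ y : ι → ℝ, hermiteProd ν y * hermiteProd μ y =
      ∏ j ∈ ν.support ∪ μ.support, hermiteFun (ν j) (y j) * hermiteFun (μ j) (y j) := by
    intro y
    rw [Finset.prod_mul_distrib, ← hermiteProd_eq_prod Finset.subset_union_left,
      ← hermiteProd_eq_prod Finset.subset_union_right]
  simp only [e]
  rw [integral_prod_gaussProd (g := fun j x => hermiteFun (ν j) x * hermiteFun (μ j) x)
    (fun j => (measurable_hermiteFun _).mul (measurable_hermiteFun _))]
  simp only [integral_hermiteFun_mul]
  split_ifs with h
  · subst h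
    simp
  · obtain ⟨j, hj⟩ : ∃ j, ν j ≠ μ j := by
      by_contra! hc
      exact h (Finsupp.ext hc)
    refine Finset.prod_eq_zero (i := j) ?_ (if_neg hj)
    rw [Finset.mem_union, Finsupp.mem_support_iff, Finsupp.mem_support_iff]
    omega

theorem inner_toLp_eq_integral {g : (ι → ℝ) → ℝ} (hg : MemLp g 2 (gaussProd ι))
    {h : (ι → ℝ) → ℝ} (hh : MemLp h 2 (gaussProd ι)) :
    inner ℝ (hg.toLp g) (hh.toLp h) = ∫ y, g y * h y ∂(gaussProd ι) := by
  rw [L2.inner_def]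
  refine integral_congr_ae ?_
  filter_upwards [hg.coeFn_toLp, hh.coeFn_toLp] with x h1 h2
  rw [h1, h2]
  simp [mul_comm]

theorem norm_sq_toLp {g : (ι → ℝ) → ℝ} (hg : MemLp g 2 (gaussProd ι)) :
    ‖hg.toLp g‖ ^ 2 = ∫ y, g y ^ 2 ∂(gaussProd ι) := by
  rw [← real_inner_self_eq_norm_sq, inner_toLp_eq_integral]
  simp only [sq]

theorem orthonormal_toLp_hermiteProd :
    Orthonormal ℝ fun ν : ι →₀ ℕ => (memLp_hermiteProd ν).toLp (hermiteProd ν) := by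
  classical
  rw [orthonormal_iff_ite]
  intro i j
  rw [inner_toLp_eq_integral, integral_hermiteProd_mul]

/-- Bessel's inequality for the tensor-product Hermite polynomials. -/
theorem sum_sq_integral_hermiteProd_le {g : (ι → ℝ) → ℝ} (hg : MemLp g 2 (gaussProd ι))
    (T : Finset (ι →₀ ℕ)) :
    ∑ ν ∈ T, (∫ y, hermiteProd ν y * g y ∂(gaussProd ι)) ^ 2 ≤ ∫ y, g y ^ 2 ∂(gaussProd ι) := by
  have h := orthonormal_toLp_hermiteProd.sum_inner_products_le (hg.toLp g) (s := T)
  rw [norm_sq_toLp] at h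
  refine le_of_eq_of_le (Finset.sum_congr rfl fun ν _ => ?_) h
  rw [inner_toLp_eq_integral, Real.norm_eq_abs, sq_abs]

/-! ### Averages over boxes -/

/-- The closed interval with centre `c` and radius `r`. -/
def interval (c r : ℝ) : Set ℝ := {x | |x - c| ≤ r}

theorem measurableSet_interval (c r : ℝ) : MeasurableSet (interval c r) := by
  have : IsClosed (interval c r) := isClosed_le (by fun_prop) continuous_const
  exact this.measurableSet

theorem stdGauss_interval_ne_zero (c : ℝ) {r : ℝ} (hr : 0 < r) : stdGauss (interval c r) ≠ 0 := by
  intro h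
  have h2 := gaussianReal_absolutelyContinuous' 0 (one_ne_zero (α := NNReal)) h
  have h3 : interval c r = Set.Icc (c - r) (c + r) := by
    ext x
    simp only [interval, Set.mem_ofPred_eq, abs_le, Set.mem_Icc]
    constructor <;> rintro ⟨_, _⟩ <;> constructor <;> linarith
  rw [h3, Real.volume_Icc, ENNReal.ofReal_eq_zero] at h2
  linarith

/-- The Gaussian average of `H_n` over an interval. -/
def hermiteAvg (c r : ℝ) (n : ℕ) : ℝ := ⨍ x in interval c r, hermiteFun n x ∂stdGauss

theorem integrable_hermiteFun (n : ℕ) : Integrable (hermiteFun n) stdGauss :=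
  (memLp_hermiteFun n).integrable one_le_two

theorem setIntegral_hermiteFun {c r : ℝ} (h : stdGauss (interval c r) ≠ 0) (n : ℕ) :
    ∫ x in interval c r, hermiteFun n x ∂stdGauss =
      stdGauss.real (interval c r) * hermiteAvg c r n := by
  rw [hermiteAvg, setAverage_eq, smul_eq_mul, ← mul_assoc, mul_inv_cancel₀, one_mul]
  rw [Measure.real]
  exact ENNReal.toReal_ne_zero.2 ⟨h, measure_ne_top _ _⟩

theorem hermiteAvg_zero {c r : ℝ} (h : stdGauss (interval c r) ≠ 0) : hermiteAvg c r 0 = 1 := by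
  rw [hermiteAvg]
  simp only [hermiteFun_zero]
  exact setAverage_const h (measure_ne_top _ _) 1

theorem abs_hermiteAvg_le {c r R : ℝ} (h : stdGauss (interval c r) ≠ 0)
    (hR : |c| + r ≤ R) (n : ℕ) : |hermiteAvg c r n| ≤ Real.exp (R ^ 2 / 2) := by
  have := (convex_closedBall (0 : ℝ) (Real.exp (R ^ 2 / 2))).set_average_mem
    Metric.isClosed_closedBall h (measure_ne_top _ _) (f := hermiteFun n) ?_
    (integrable_hermiteFun n).integrableOn
  · simpa [hermiteAvg] using this
  · refine (ae_restrict_mem (measurableSet_interval c r)).mono fun x hx => ?_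
    rw [mem_closedBall_zero_iff, Real.norm_eq_abs]
    refine (abs_hermiteFun_le n x).trans ?_
    have h1 : |x| ≤ R := by
      have h2 : |x| ≤ |c| + |x - c| := by
        have := abs_add_le c (x - c)
        simpa using this
      have h3 : |x - c| ≤ r := hx
      linarith
    have := sq_le_sq' (by linarith [neg_abs_le x, abs_nonneg x, neg_le_neg h1]) (le_of_abs_le h1)
    gcongr

/-- A bound for the averages of Hermite polynomials over all intervals centred at `0`. -/
def centredBound : ℝ := Real.exp (1 / 2) + (stdGauss.real (interval 0 1))⁻¹

theorem one_le_centredBound : 1 ≤ centredBound := by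
  have h1 : (0 : ℝ) ≤ (stdGauss.real (interval 0 1))⁻¹ := by positivity
  have h2 : (1 : ℝ) ≤ Real.exp (1 / 2) := Real.one_le_exp (by norm_num)
  rw [centredBound]
  linarith

/-- Small radii are covered by the pointwise bound on `[-1, 1]`, large ones by `‖H_n‖_{L¹} ≤ 1` and
a lower bound for the mass. All radii are needed: in infinitely many coordinates a box of positive
measure has half-widths tending to infinity, so no `ε` makes them uniformly small. -/
theorem abs_hermiteAvg_zero_le {r : ℝ} (hr : 0 < r) (n : ℕ) :
    |hermiteAvg 0 r n| ≤ centredBound := by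
  have h0 := stdGauss_interval_ne_zero 0 hr
  rcases le_total r 1 with h | h
  · refine (abs_hermiteAvg_le h0 (R := 1) (by simpa using h) n).trans ?_
    have h1 : (0 : ℝ) ≤ (stdGauss.real (interval 0 1))⁻¹ := by positivity
    rw [centredBound]
    norm_num at h1 ⊢
  · have hsub : interval 0 1 ⊆ interval 0 r := fun x hx => le_trans hx h
    have hpos : 0 < stdGauss.real (interval 0 1) :=
      ENNReal.toReal_pos (stdGauss_interval_ne_zero 0 one_pos) (measure_ne_top _ _)
    have hle : stdGauss.real (interval 0 1) ≤ stdGauss.real (interval 0 r) :=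
      measureReal_mono hsub
    have hint : |∫ x in interval 0 r, hermiteFun n x ∂stdGauss| ≤ 1 := by
      calc |∫ x in interval 0 r, hermiteFun n x ∂stdGauss|
          ≤ ∫ x in interval 0 r, |hermiteFun n x| ∂stdGauss := abs_integral_le_integral_abs
        _ ≤ ∫ x, |hermiteFun n x| ∂stdGauss :=
          setIntegral_le_integral (integrable_hermiteFun n).abs (ae_of_all _ fun x => abs_nonneg _)
        _ ≤ ∫ x, (1 + hermiteFun n x * hermiteFun n x) / 2 ∂stdGauss := by
          have hi := (memLp_hermiteFun n).integrable_mul (memLp_hermiteFun n)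
          refine integral_mono (integrable_hermiteFun n).abs
            (((integrable_const 1).add hi).div_const 2) fun x => ?_
          simp only
          nlinarith [sq_nonneg (|hermiteFun n x| - 1), sq_abs (hermiteFun n x)]
        _ = 1 := by
          have hi : Integrable (fun x => hermiteFun n x * hermiteFun n x) stdGauss :=
            (memLp_hermiteFun n).integrable_mul (memLp_hermiteFun n)
          rw [integral_div, integral_add (integrable_const 1) hi, integral_hermiteFun_mul]
          simp
    rw [hermiteAvg, setAverage_eq, smul_eq_mul, abs_mul, abs_of_nonneg (by positivity)]
    calc (stdGauss.real (interval 0 r))⁻¹ * |∫ x in interval 0 r, hermiteFun n x ∂stdGauss|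
        ≤ (stdGauss.real (interval 0 1))⁻¹ * 1 := by gcongr
      _ ≤ centredBound := by
        rw [centredBound, mul_one]
        linarith [Real.exp_pos (1 / 2)]

theorem tendsto_hermiteAvg (c : ℝ) {w : ℝ} (hw : 0 < w) (n : ℕ) :
    Tendsto (fun ε => hermiteAvg c (ε * w) n) (𝓝[>] 0) (𝓝 (hermiteFun n c)) := by
  rw [Metric.tendsto_nhds]
  intro δ hδ
  obtain ⟨η, hη, hc⟩ := Metric.continuous_iff.1 (continuous_hermiteFun n) c (δ / 2) (half_pos hδ)
  have hmem : Set.Ioo 0 (η / w) ∈ 𝓝[>] (0 : ℝ) := Ioo_mem_nhdsGT (div_pos hη hw)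
  filter_upwards [hmem] with ε hε
  have hr : 0 < ε * w := mul_pos hε.1 hw
  have hr2 : ε * w < η := (lt_div_iff₀ hw).1 hε.2
  have := (convex_closedBall (hermiteFun n c) (δ / 2)).set_average_mem Metric.isClosed_closedBall
    (stdGauss_interval_ne_zero c hr) (measure_ne_top _ _) (f := hermiteFun n) ?_
    (integrable_hermiteFun n).integrableOn
  · exact lt_of_le_of_lt this (half_lt_self hδ)
  · refine (ae_restrict_mem (measurableSet_interval c _)).mono fun x hx => ?_
    exact (hc x (lt_of_le_of_lt hx hr2)).le

/-- This is Parseval's identity for the indicator of the interval, divided by the square of its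
mass. -/
theorem hasSum_sq_hermiteAvg {c r : ℝ} (h : stdGauss (interval c r) ≠ 0) :
    HasSum (fun n => hermiteAvg c r n ^ 2) (stdGauss.real (interval c r))⁻¹ := by
  have hm := measurableSet_interval c r
  have hp : 0 < stdGauss.real (interval c r) := ENNReal.toReal_pos h (measure_ne_top _ _)
  have hu : MemLp ((interval c r).indicator fun _ => (1 : ℝ)) 2 stdGauss :=
    memLp_indicator_const 2 hm 1 (Or.inr (measure_ne_top _ _))
  have hs := (hasSum_sq_integral_hermiteFun hu).mul_left ((stdGauss.real (interval c r))⁻¹ ^ 2)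
  have e1 : ∫ x, (interval c r).indicator (fun _ => (1 : ℝ)) x ^ 2 ∂stdGauss =
      stdGauss.real (interval c r) := by
    have : ∀ x, (interval c r).indicator (fun _ => (1 : ℝ)) x ^ 2 =
        (interval c r).indicator (fun _ => (1 : ℝ)) x := by
      intro x
      by_cases hx : x ∈ interval c r <;> simp [hx]
    simp only [this]
    rw [integral_indicator hm]
    simp
  have e2 : (stdGauss.real (interval c r))⁻¹ =
      (stdGauss.real (interval c r))⁻¹ ^ 2 * stdGauss.real (interval c r) := by
    field_simp
  rw [e1, ← e2] at hs
  refine hs.congr_fun fun n => ?_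
  have e3 : ∫ x, hermiteFun n x * (interval c r).indicator (fun _ => (1 : ℝ)) x ∂stdGauss =
      ∫ x in interval c r, hermiteFun n x ∂stdGauss := by
    rw [← integral_indicator hm]
    refine integral_congr_ae (ae_of_all _ fun x => ?_)
    by_cases hx : x ∈ interval c r <;> simp [hx]
  rw [e3, setIntegral_hermiteFun h]
  field_simp

/-! ### Boxes in the product space and their Hermite expansion -/

/-- The cylinder over a box in the coordinates of `s`. -/
def boxOn (s : Finset ι) (y a : ι → ℝ) : Set (ι → ℝ) := {z | ∀ j ∈ s, |z j - y j| ≤ a j}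

theorem boxOn_eq (s : Finset ι) (y a : ι → ℝ) :
    boxOn s y a = ⋂ j ∈ s, (fun z => z j) ⁻¹' interval (y j) (a j) := by
  ext z
  simp [boxOn, interval]

theorem measurableSet_boxOn (s : Finset ι) (y a : ι → ℝ) : MeasurableSet (boxOn s y a) := by
  rw [boxOn_eq]
  exact Finset.measurableSet_biInter s fun j _ => measurable_pi_apply j (measurableSet_interval _ _)

theorem iInter_boxOn (y a : ι → ℝ) : ⋂ s : Finset ι, boxOn s y a = box y a := by
  ext z
  simp only [boxOn, box, Set.mem_iInter, Set.mem_ofPred_eq]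
  exact ⟨fun h j => h {j} j (Finset.mem_singleton_self j), fun h s j _ => h j⟩

theorem box_subset_boxOn (s : Finset ι) (y a : ι → ℝ) : box y a ⊆ boxOn s y a := by
  rw [← iInter_boxOn]
  exact Set.iInter_subset _ s

theorem antitone_boxOn (y a : ι → ℝ) : Antitone fun s : Finset ι => boxOn s y a :=
  fun _ _ hst _ hz j hj => hz j (hst hj)

theorem measurableSet_box [Countable ι] (y a : ι → ℝ) : MeasurableSet (box y a) := by
  rw [← iInter_boxOn]
  exact MeasurableSet.iInter fun s => measurableSet_boxOn s y a

theorem setIntegral_boxOn_hermiteProd {ν : ι →₀ ℕ} {s : Finset ι} (hs : ν.support ⊆ s)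
    (y a : ι → ℝ) :
    ∫ z in boxOn s y a, hermiteProd ν z ∂(gaussProd ι) =
      ∏ j ∈ s, ∫ x in interval (y j) (a j), hermiteFun (ν j) x ∂stdGauss := by
  rw [← integral_indicator (measurableSet_boxOn s y a)]
  have e : ∀ z, (boxOn s y a).indicator (hermiteProd ν) z =
      ∏ j ∈ s, (interval (y j) (a j)).indicator (hermiteFun (ν j)) (z j) := by
    intro z
    by_cases hz : z ∈ boxOn s y a
    · rw [Set.indicator_of_mem hz, hermiteProd_eq_prod hs]
      refine Finset.prod_congr rfl fun j hj => ?_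
      rw [Set.indicator_of_mem]
      exact hz j hj
    · rw [Set.indicator_of_notMem hz]
      simp only [boxOn, Set.mem_ofPred_eq, not_forall] at hz
      obtain ⟨j, hj, hzj⟩ := hz
      exact (Finset.prod_eq_zero hj (Set.indicator_of_notMem (s := interval (y j) (a j)) hzj _)).symm
  simp only [e]
  rw [integral_prod_gaussProd fun j =>
    (measurable_hermiteFun (ν j)).indicator (measurableSet_interval _ _)]
  exact Finset.prod_congr rfl fun j _ => integral_indicator (measurableSet_interval _ _)

theorem measureReal_boxOn (s : Finset ι) (y a : ι → ℝ) :
    (gaussProd ι).real (boxOn s y a) = ∏ j ∈ s, stdGauss.real (interval (y j) (a j)) := by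
  have := setIntegral_boxOn_hermiteProd (ν := 0) (s := s) (by simp) y a
  simpa [hermiteProd] using this

theorem stdGauss_interval_ne_zero_of_box {y a : ι → ℝ} (h : gaussProd ι (box y a) ≠ 0) (j : ι) :
    stdGauss (interval (y j) (a j)) ≠ 0 := by
  intro h0
  have h1 := measureReal_boxOn {j} y a
  rw [Finset.prod_singleton, Measure.real, Measure.real, h0, ENNReal.toReal_zero,
    ENNReal.toReal_eq_zero_iff, or_iff_left (measure_ne_top _ _)] at h1
  exact h (measure_mono_null (box_subset_boxOn {j} y a) h1)

section Countable

variable [Countable ι]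

theorem tendsto_measureReal_boxOn (y a : ι → ℝ) :
    Tendsto (fun s : Finset ι => ∏ j ∈ s, stdGauss.real (interval (y j) (a j))) atTop
      (𝓝 ((gaussProd ι).real (box y a))) := by
  have h := tendsto_setIntegral_of_antitone (μ := gaussProd ι) (f := fun _ => (1 : ℝ))
    (fun s => measurableSet_boxOn s y a) (antitone_boxOn y a)
    ⟨∅, (integrable_const 1).integrableOn⟩
  rw [iInter_boxOn] at h
  simpa [measureReal_boxOn] using h

/-- The box is the decreasing limit of its cylinders. Once a cylinder involves all of `supp ν`, the
ratio of the integral to the mass no longer changes, since `H_0` has average `1`. -/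
theorem setIntegral_box_hermiteProd {y a : ι → ℝ} (h : gaussProd ι (box y a) ≠ 0) (ν : ι →₀ ℕ) :
    ∫ z in box y a, hermiteProd ν z ∂(gaussProd ι) =
      (gaussProd ι).real (box y a) * ν.prod fun j n => hermiteAvg (y j) (a j) n := by
  have hj := stdGauss_interval_ne_zero_of_box h
  have h1 := tendsto_setIntegral_of_antitone (μ := gaussProd ι) (f := hermiteProd ν)
    (fun s => measurableSet_boxOn s y a) (antitone_boxOn y a)
    ⟨∅, (integrable_hermiteProd ν).integrableOn⟩
  rw [iInter_boxOn] at h1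
  refine tendsto_nhds_unique_of_eventuallyEq h1 ((tendsto_measureReal_boxOn y a).mul_const _) ?_
  filter_upwards [eventually_ge_atTop ν.support] with s hs
  rw [setIntegral_boxOn_hermiteProd hs, finsupp_prod_eq_prod (fun j => hermiteAvg_zero (hj j)) hs,
    ← Finset.prod_mul_distrib]
  exact Finset.prod_congr rfl fun j _ => setIntegral_hermiteFun (hj j) _

/-- Parseval's identity for the indicator function of a box. -/
theorem hasSum_sq_setIntegral_box {y a : ι → ℝ} (h : gaussProd ι (box y a) ≠ 0) :
    HasSum (fun ν : ι →₀ ℕ => (∫ z in box y a, hermiteProd ν z ∂(gaussProd ι)) ^ 2)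
      ((gaussProd ι).real (box y a)) := by
  have hb := measurableSet_box y a
  have hj := stdGauss_interval_ne_zero_of_box h
  have hu : MemLp ((box y a).indicator fun _ => (1 : ℝ)) 2 (gaussProd ι) :=
    memLp_indicator_const 2 hb 1 (Or.inr (measure_ne_top _ _))
  have hpos : 0 < (gaussProd ι).real (box y a) := ENNReal.toReal_pos h (measure_ne_top _ _)
  -- Bessel's inequality gives one direction.
  have hle : ∀ T : Finset (ι →₀ ℕ),
      ∑ ν ∈ T, (∫ z in box y a, hermiteProd ν z ∂(gaussProd ι)) ^ 2 ≤
        (gaussProd ι).real (box y a) := by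
    intro T
    have h1 := sum_sq_integral_hermiteProd_le hu T
    have e1 : ∫ z, (box y a).indicator (fun _ => (1 : ℝ)) z ^ 2 ∂(gaussProd ι) =
        (gaussProd ι).real (box y a) := by
      have : ∀ z, (box y a).indicator (fun _ => (1 : ℝ)) z ^ 2 =
          (box y a).indicator (fun _ => (1 : ℝ)) z := by
        intro z
        by_cases hx : z ∈ box y a <;> simp [hx]
      simp only [this]
      rw [integral_indicator hb]
      simp
    rw [e1] at h1
    refine le_of_eq_of_le (Finset.sum_congr rfl fun ν _ => ?_) h1
    congr 1
    rw [← integral_indicator hb]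
    refine integral_congr_ae (ae_of_all _ fun z => ?_)
    by_cases hz : z ∈ box y a <;> simp [hz]
  refine hasSum_of_isLUB_of_nonneg _ (fun ν => sq_nonneg _) ⟨?_, ?_⟩
  · rintro _ ⟨T, rfl⟩
    exact hle T
  · intro B hB
    have hB' : ∀ T : Finset (ι →₀ ℕ),
        ∑ ν ∈ T, (∫ z in box y a, hermiteProd ν z ∂(gaussProd ι)) ^ 2 ≤ B := fun T => hB ⟨T, rfl⟩
    -- For the other direction, restrict to `ν` supported in a finite `s`. With `m` the mass of the
    -- box and `p_j` those of its sides, the sum of squares factorises to `m² ∏_{j ∈ s} p_j⁻¹`, and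
    -- this tends to `m` because `∏_{j ∈ s} p_j → m > 0`.
    have key : ∀ s : Finset ι, (gaussProd ι).real (box y a) ^ 2 *
        ∏ j ∈ s, (stdGauss.real (interval (y j) (a j)))⁻¹ ≤ B := by
      intro s
      have ht : Tendsto (fun M : ℕ => (gaussProd ι).real (box y a) ^ 2 *
          ∏ j ∈ s, ∑ n ∈ Finset.range M, hermiteAvg (y j) (a j) n ^ 2) atTop
          (𝓝 ((gaussProd ι).real (box y a) ^ 2 *
            ∏ j ∈ s, (stdGauss.real (interval (y j) (a j)))⁻¹)) :=
        (tendsto_finsetProd s fun j _ =>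
          (hasSum_sq_hermiteAvg (hj j)).tendsto_sum_nat).const_mul _
      refine le_of_tendsto' ht fun M => ?_
      rw [← sum_finsupp_prod s (fun _ => Finset.range M)
        (fun j n => hermiteAvg (y j) (a j) n ^ 2), Finset.mul_sum]
      refine le_of_eq_of_le (Finset.sum_congr rfl fun ν hν => ?_)
        (hB' (s.finsupp fun _ => Finset.range M))
      rw [setIntegral_box_hermiteProd h, mul_pow,
        finsupp_prod_eq_prod (fun j => hermiteAvg_zero (hj j)) (Finset.mem_finsupp_iff.1 hν).1,
        Finset.prod_pow]
    have ht := ((tendsto_measureReal_boxOn y a).inv₀ hpos.ne').const_mul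
      ((gaussProd ι).real (box y a) ^ 2)
    simp only [← Finset.prod_inv_distrib] at ht
    have := le_of_tendsto' ht key
    rwa [sq, mul_assoc, mul_inv_cancel₀ hpos.ne', mul_one] at this

/-- Averages over boxes may be computed termwise from the Hermite expansion. -/
theorem hasSum_average_box {y a : ι → ℝ} (h : gaussProd ι (box y a) ≠ 0) {g : (ι → ℝ) → ℝ}
    (hg : MemLp g 2 (gaussProd ι)) :
    HasSum (fun ν : ι →₀ ℕ => (ν.prod fun j n => hermiteAvg (y j) (a j) n) *
      ∫ z, hermiteProd ν z * g z ∂(gaussProd ι)) (⨍ z in box y a, g z ∂(gaussProd ι)) := by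
  have hb := measurableSet_box y a
  have hu : MemLp ((box y a).indicator fun _ => (1 : ℝ)) 2 (gaussProd ι) :=
    memLp_indicator_const 2 hb 1 (Or.inr (measure_ne_top _ _))
  have hpos : 0 < (gaussProd ι).real (box y a) := ENNReal.toReal_pos h (measure_ne_top _ _)
  have hin : ∀ w : (ι → ℝ) → ℝ,
      ∫ z, w z * (box y a).indicator (fun _ => (1 : ℝ)) z ∂(gaussProd ι) =
        ∫ z in box y a, w z ∂(gaussProd ι) := by
    intro w
    rw [← integral_indicator hb]
    refine integral_congr_ae (ae_of_all _ fun z => ?_)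
    by_cases hz : z ∈ box y a <;> simp [hz]
  have hp : HasSum (fun ν : ι →₀ ℕ =>
      inner ℝ ((memLp_hermiteProd ν).toLp (hermiteProd ν)) (hu.toLp _) ^ 2)
      (‖hu.toLp ((box y a).indicator fun _ => (1 : ℝ))‖ ^ 2) := by
    rw [← real_inner_self_eq_norm_sq, inner_toLp_eq_integral, hin, setIntegral_congr_fun hb
      (fun z hz => Set.indicator_of_mem hz _)]
    simp only [inner_toLp_eq_integral, hin]
    simpa using hasSum_sq_setIntegral_box h
  have hs := (hasSum_inner_mul_inner_of_hasSum_sq orthonormal_toLp_hermiteProd hp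
    (hg.toLp g)).mul_left ((gaussProd ι).real (box y a))⁻¹
  rw [real_inner_comm] at hs
  simp only [inner_toLp_eq_integral, hin] at hs
  rw [setAverage_eq, smul_eq_mul]
  refine hs.congr_fun fun ν => ?_
  rw [setIntegral_box_hermiteProd h]
  field_simp

/-- At a point with finitely many nonzero coordinates whose value is a local average, a function
is the sum of its Hermite expansion, provided the coefficients decay suitably. -/
theorem hasSum_hermiteProd_of_isAverageValueAt {g : (ι → ℝ) → ℝ} (hg : MemLp g 2 (gaussProd ι))
    (hsum : Summable fun ν : ι →₀ ℕ =>
      |∫ z, hermiteProd ν z * g z ∂(gaussProd ι)| * centredBound ^ ν.support.card)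
    {y : ι → ℝ} (hy : {j | y j ≠ 0}.Finite) (hav : IsAverageValueAt g y) :
    HasSum (fun ν : ι →₀ ℕ => (∫ z, hermiteProd ν z * g z ∂(gaussProd ι)) * hermiteProd ν y)
      (g y) := by
  classical
  obtain ⟨w, hw, hbox, hlim⟩ := hav
  set x : (ι →₀ ℕ) → ℝ := fun ν => ∫ z, hermiteProd ν z * g z ∂(gaussProd ι) with hx
  -- For `ε ≤ 1` the averages in coordinate `j` are at most `k j * centredBound`. As `k j = 1`
  -- wherever `y j = 0`, all products of the `k j` stay below the finite product `K`.
  set k : ι → ℝ := fun j => if y j = 0 then 1 else Real.exp ((|y j| + w j) ^ 2 / 2) with hk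
  have hk1 : ∀ j, 1 ≤ k j := by
    intro j
    simp only [hk]
    split_ifs
    · exact le_rfl
    · exact Real.one_le_exp (by positivity)
  set K : ℝ := ∏ j ∈ hy.toFinset, k j with hK
  have hav1 : ∀ ε : ℝ, 0 < ε → ε ≤ 1 → ∀ j n,
      |hermiteAvg (y j) (ε * w j) n| ≤ k j * centredBound := by
    intro ε hε hε1 j n
    simp only [hk]
    split_ifs with h0
    · rw [h0, one_mul]
      exact abs_hermiteAvg_zero_le (mul_pos hε (hw j)) n
    · refine (abs_hermiteAvg_le (stdGauss_interval_ne_zero _ (mul_pos hε (hw j)))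
        (R := |y j| + w j) ?_ n).trans (le_mul_of_one_le_right (Real.exp_pos _).le
        one_le_centredBound)
      have := mul_le_of_le_one_left (hw j).le hε1
      linarith
  have hprod : ∀ ε : ℝ, 0 < ε → ε ≤ 1 → ∀ ν : ι →₀ ℕ,
      |ν.prod fun j n => hermiteAvg (y j) (ε * w j) n| ≤ K * centredBound ^ ν.support.card := by
    intro ε hε hε1 ν
    rw [Finsupp.prod, Finset.abs_prod]
    calc ∏ j ∈ ν.support, |hermiteAvg (y j) (ε * w j) (ν j)|
        ≤ ∏ j ∈ ν.support, k j * centredBound :=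
          Finset.prod_le_prod (fun j _ => abs_nonneg _) fun j _ => hav1 ε hε hε1 j _
      _ = (∏ j ∈ ν.support, k j) * centredBound ^ ν.support.card := by
          rw [Finset.prod_mul_distrib, Finset.prod_const]
      _ ≤ K * centredBound ^ ν.support.card := by
          have : (0 : ℝ) ≤ centredBound := zero_le_one.trans one_le_centredBound
          gcongr
          calc ∏ j ∈ ν.support, k j ≤ ∏ j ∈ ν.support ∪ hy.toFinset, k j :=
                Finset.prod_le_prod_of_subset_of_one_le Finset.subset_union_left
                  (fun j _ => zero_le_one.trans (hk1 j)) fun j _ _ => hk1 j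
            _ = K := by
                symm
                refine Finset.prod_subset Finset.subset_union_right fun j _ hj => ?_
                rw [Set.Finite.mem_toFinset] at hj
                simp only [Set.mem_ofPred_eq, not_not] at hj
                simp [hk, hj]
  have hbd : Summable fun ν : ι →₀ ℕ => K * (|x ν| * centredBound ^ ν.support.card) :=
    hsum.mul_left K
  have hpt : ∀ ν : ι →₀ ℕ, Tendsto
      (fun ε => (ν.prod fun j n => hermiteAvg (y j) (ε * w j) n) * x ν) (𝓝[>] 0)
      (𝓝 (x ν * hermiteProd ν y)) := by
    intro ν
    rw [mul_comm (x ν)]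
    refine Tendsto.mul_const _ ?_
    exact tendsto_finsetProd _ fun j _ => tendsto_hermiteAvg (y j) (hw j) _
  have hdom : ∀ᶠ ε : ℝ in 𝓝[>] 0, ∀ ν : ι →₀ ℕ,
      ‖(ν.prod fun j n => hermiteAvg (y j) (ε * w j) n) * x ν‖ ≤
        K * (|x ν| * centredBound ^ ν.support.card) := by
    filter_upwards [Ioc_mem_nhdsGT (zero_lt_one (α := ℝ))] with ε hε ν
    rw [norm_mul, Real.norm_eq_abs, Real.norm_eq_abs]
    calc _ ≤ (K * centredBound ^ ν.support.card) * |x ν| := by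
          gcongr
          exact hprod ε hε.1 hε.2 ν
      _ = _ := by ring
  have ht := tendsto_tsum_of_dominated_convergence hbd hpt hdom
  have hsummable : Summable fun ν => x ν * hermiteProd ν y := by
    refine Summable.of_norm_bounded hbd fun ν => ?_
    exact le_of_tendsto (hpt ν).norm (hdom.mono fun ε h => h ν)
  have heq : (∑' ν, x ν * hermiteProd ν y) = g y := by
    refine tendsto_nhds_unique_of_eventuallyEq ht hlim ?_
    filter_upwards [self_mem_nhdsWithin] with ε hε
    exact (hasSum_average_box (hbox ε hε) hg).tsum_eq
  rw [← heq]
  exact hsummable.hasSum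

end Countable

/-! ### Truncated Hermite polynomials as test functions -/

/-- A smooth bump on the line, equal to `1` on `[-1, 1]` and supported in `[-2, 2]`. -/
def bump : ContDiffBump (0 : ℝ) := ⟨1, 2, one_pos, one_lt_two⟩

/-- The rescaled bump, equal to `1` on `[-(n + 1), n + 1]`. -/
def cutoff (n : ℕ) (x : ℝ) : ℝ := bump (x / (n + 1))

/-- The derivative of `cutoff n`. -/
def cutoffDeriv (n : ℕ) (x : ℝ) : ℝ := deriv bump (x / (n + 1)) / (n + 1)

theorem hasDerivAt_cutoff (n : ℕ) (x : ℝ) : HasDerivAt (cutoff n) (cutoffDeriv n x) x := by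
  have h1 : HasDerivAt bump (deriv bump (x / (n + 1))) (x / (n + 1)) :=
    ((bump.contDiff (n := 1)).differentiable one_ne_zero _).hasDerivAt
  have h2 : HasDerivAt (fun x : ℝ => x / (n + 1)) (1 / (n + 1)) x := (hasDerivAt_id x).div_const _
  refine (h1.comp x h2).congr_deriv ?_
  rw [cutoffDeriv]
  ring

theorem contDiff_cutoff (n : ℕ) : ContDiff ℝ ∞ (cutoff n) :=
  bump.contDiff.comp (contDiff_id.div_const _)

theorem continuous_cutoffDeriv (n : ℕ) : Continuous (cutoffDeriv n) := by
  have h : Continuous (deriv bump) := (bump.contDiff (n := 1)).continuous_deriv le_rfl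
  unfold cutoffDeriv
  fun_prop

theorem abs_cutoff_le (n : ℕ) (x : ℝ) : |cutoff n x| ≤ 1 := by
  rw [cutoff, abs_of_nonneg bump.nonneg]
  exact bump.le_one

/-- The bound decaying in `n` makes the error term of the truncation vanish in the limit; the one
free of `n` dominates it. -/
theorem exists_abs_cutoffDeriv_le :
    ∃ C : ℝ, 0 ≤ C ∧ ∀ n x, |cutoffDeriv n x| ≤ C / (n + 1) ∧ |cutoffDeriv n x| ≤ C := by
  have h : Continuous (deriv bump) := (bump.contDiff (n := 1)).continuous_deriv le_rfl
  obtain ⟨C, hC⟩ := bump.hasCompactSupport.deriv.exists_bound_of_continuous h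
  have hC0 : 0 ≤ C := (norm_nonneg _).trans (hC 0)
  refine ⟨C, hC0, fun n x => ?_⟩
  have h1 : |cutoffDeriv n x| ≤ C / (n + 1) := by
    rw [cutoffDeriv, abs_div, abs_of_pos (by positivity : (0 : ℝ) < n + 1)]
    gcongr
    exact hC _
  refine ⟨h1, h1.trans (div_le_self hC0 ?_)⟩
  linarith [Nat.cast_nonneg (α := ℝ) n]

theorem tendsto_cutoff (x : ℝ) : Tendsto (fun n => cutoff n x) atTop (𝓝 1) := by
  obtain ⟨N, hN⟩ := exists_nat_ge |x|
  refine tendsto_const_nhds.congr' ?_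
  filter_upwards [eventually_ge_atTop N] with n hn
  refine (bump.one_of_mem_closedBall ?_).symm
  rw [mem_closedBall_zero_iff, Real.norm_eq_abs, abs_div,
    abs_of_pos (by positivity : (0 : ℝ) < n + 1)]
  have : (N : ℝ) ≤ n := by exact_mod_cast hn
  exact (div_le_one (by positivity)).2 (by linarith)

theorem tendsto_cutoffDeriv (x : ℝ) : Tendsto (fun n => cutoffDeriv n x) atTop (𝓝 0) := by
  obtain ⟨C, _, hC⟩ := exists_abs_cutoffDeriv_le
  refine squeeze_zero_norm (fun n => (hC n x).1) ?_
  have := (tendsto_one_div_add_atTop_nhds_zero_nat (𝕜 := ℝ)).const_mul C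
  simpa [div_eq_mul_inv] using this

theorem isTestFun_prod_cutoff (n : ℕ) (s : Finset ι) (ν : ι →₀ ℕ) :
    IsTestFun fun y : ι → ℝ => ∏ i ∈ s, cutoff n (y i) * hermiteFun (ν i) (y i) := by
  refine ⟨s, fun y => ∏ i : s, cutoff n (y i) * hermiteFun (ν i) (y i), ?_, ?_, fun y => ?_⟩
  · refine contDiff_prod fun i _ => ?_
    have h1 := contDiff_cutoff n
    have h2 := contDiff_hermiteFun (ν i)
    exact (h1.comp (contDiff_apply ℝ ℝ i)).mul (h2.comp (contDiff_apply ℝ ℝ i))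
  · refine HasCompactSupport.of_support_subset_isCompact
      (isCompact_univ_pi fun _ : s => isCompact_Icc (a := -(2 * (n + 1 : ℝ))) (b := 2 * (n + 1)))
      fun y hy i _ => ?_
    rw [Function.mem_support, Finset.prod_ne_zero_iff] at hy
    have h1 : cutoff n (y i) ≠ 0 := left_ne_zero_of_mul (hy i (Finset.mem_univ i))
    have h2 : y i / (n + 1) ∈ Function.support bump := h1
    rw [bump.support_eq, mem_ball_zero_iff, Real.norm_eq_abs, abs_div,
      abs_of_pos (by positivity : (0 : ℝ) < n + 1), div_lt_iff₀ (by positivity)] at h2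
    exact Set.mem_Icc.2 (abs_le.1 h2.le)
  · exact (Finset.prod_coe_sort s fun i => cutoff n (y i) * hermiteFun (ν i) (y i)).symm

open Classical in
theorem lineDeriv_prod_single {g g' : ι → ℝ → ℝ} {s : Finset ι} {j : ι} (hj : j ∈ s)
    (hg : ∀ x, HasDerivAt (g j) (g' j x) x) (y : ι → ℝ) :
    lineDeriv ℝ (fun y => ∏ i ∈ s, g i (y i)) y (Pi.single j 1) =
      g' j (y j) * ∏ i ∈ s.erase j, g i (y i) := by
  refine HasLineDerivAt.lineDeriv ?_
  have e : ∀ t : ℝ, ∏ i ∈ s, g i ((y + t • (Pi.single j (1 : ℝ) : ι → ℝ)) i) =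
      g j (y j + t) * ∏ i ∈ s.erase j, g i (y i) := by
    intro t
    rw [← Finset.mul_prod_erase s _ hj]
    congr 1
    · simp
    · refine Finset.prod_congr rfl fun i hi => ?_
      simp [Finset.ne_of_mem_erase hi]
  rw [HasLineDerivAt]
  simp only [e]
  refine HasDerivAt.mul_const ?_ _
  have h := (hg (y j + 0)).comp_const_add (y j) 0
  simpa using h

section Vector

variable {S : Type*} [NormedAddCommGroup S] [NormedSpace ℝ S]

theorem integrable_smul_of_memLp {a : (ι → ℝ) → ℝ} {u : (ι → ℝ) → S} (ha : MemLp a 2 (gaussProd ι))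
    (hu : MemLp u 2 (gaussProd ι)) : Integrable (fun y => a y • u y) (gaussProd ι) :=
  memLp_one_iff_integrable.1 (hu.smul ha)

theorem hermiteProd_add_single (ν : ι →₀ ℕ) (j : ι) (s : Finset ι) (hs : ν.support ⊆ s)
    (hj : j ∈ s) (y : ι → ℝ) [DecidableEq ι] :
    hermiteProd (ν + Finsupp.single j 1) y =
      hermiteFun (ν j + 1) (y j) * ∏ i ∈ s.erase j, hermiteFun (ν i) (y i) := by
  have hsub : (ν + Finsupp.single j 1).support ⊆ s := by
    refine Finsupp.support_add.trans (Finset.union_subset hs ?_)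
    exact Finsupp.support_single_subset.trans (Finset.singleton_subset_iff.2 hj)
  rw [hermiteProd_eq_prod hsub, ← Finset.mul_prod_erase s _ hj]
  congr 1
  · simp
  · refine Finset.prod_congr rfl fun i hi => ?_
    simp [Finsupp.single_eq_of_ne (Finset.ne_of_mem_erase hi)]

/-- The defining identity of weak derivatives extends from test functions to the Hermite
polynomials. -/
theorem IsWeakPartial.integral_hermiteProd {j : ι} {u v : (ι → ℝ) → S} (h : IsWeakPartial j u v)
    (hu : MemLp u 2 (gaussProd ι)) (hv : MemLp v 2 (gaussProd ι)) (ν : ι →₀ ℕ) :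
    ∫ y, hermiteProd ν y • v y ∂(gaussProd ι) =
      √(ν j + 1 : ℝ) • ∫ y, hermiteProd (ν + Finsupp.single j 1) y • u y ∂(gaussProd ι) := by
  classical
  obtain ⟨C, hC0, hC⟩ := exists_abs_cutoffDeriv_le
  set s : Finset ι := insert j ν.support with hs
  have hjs : j ∈ s := Finset.mem_insert_self _ _
  have hνs : ν.support ⊆ s := Finset.subset_insert _ _
  set φ : ℕ → (ι → ℝ) → ℝ := fun n y => ∏ i ∈ s, cutoff n (y i) * hermiteFun (ν i) (y i) with hφ
  -- This is `y_j φ - ∂_j φ`: by the raising formula `y_j H - H'` is the next Hermite polynomial up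
  -- to a factor, and the other term comes from differentiating the cutoff.
  set K : ℕ → (ι → ℝ) → ℝ := fun n y =>
    (cutoff n (y j) * (√(ν j + 1 : ℝ) * hermiteFun (ν j + 1) (y j)) -
      cutoffDeriv n (y j) * hermiteFun (ν j) (y j)) *
      ∏ i ∈ s.erase j, cutoff n (y i) * hermiteFun (ν i) (y i) with hK
  have hmc : ∀ n, Measurable (cutoff n) := fun n => (contDiff_cutoff n).continuous.measurable
  have hφm : ∀ n, Measurable (φ n) := fun n =>
    measurable_prod_eval (fun i => (hmc n).mul (measurable_hermiteFun (ν i))) s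
  have hKm : ∀ n, Measurable (K n) := by
    intro n
    have h1 : Measurable fun y : ι → ℝ =>
        ∏ i ∈ s.erase j, cutoff n (y i) * hermiteFun (ν i) (y i) :=
      measurable_prod_eval (fun i => (hmc n).mul (measurable_hermiteFun (ν i))) (s.erase j)
    have h2 : Measurable fun x : ℝ => cutoff n x * (√(ν j + 1 : ℝ) * hermiteFun (ν j + 1) x) -
        cutoffDeriv n x * hermiteFun (ν j) x :=
      ((hmc n).mul ((measurable_hermiteFun _).const_mul _)).sub
        ((continuous_cutoffDeriv n).measurable.mul (measurable_hermiteFun _))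
    exact (h2.comp (measurable_pi_apply j)).mul h1
  have hweak : ∀ n, ∫ y, K n y • u y ∂(gaussProd ι) = ∫ y, φ n y • v y ∂(gaussProd ι) := by
    intro n
    rw [← h (φ n) (isTestFun_prod_cutoff n s ν)]
    refine integral_congr_ae (ae_of_all _ fun y => ?_)
    have hd := lineDeriv_prod_single (g := fun i x => cutoff n x * hermiteFun (ν i) x)
      (g' := fun i x => cutoffDeriv n x * hermiteFun (ν i) x + cutoff n x *
        (x * hermiteFun (ν i) x - √(ν i + 1 : ℝ) * hermiteFun (ν i + 1) x)) hjs
      (fun x => (hasDerivAt_cutoff n x).mul (hasDerivAt_hermiteFun (ν j) x)) y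
    simp only [hφ, hK]
    rw [hd, ← Finset.mul_prod_erase s _ hjs]
    congr 1
    ring
  have hφt : Tendsto (fun n => ∫ y, φ n y • v y ∂(gaussProd ι)) atTop
      (𝓝 (∫ y, hermiteProd ν y • v y ∂(gaussProd ι))) := by
    refine tendsto_integral_of_dominated_convergence (fun y => ‖hermiteProd ν y • v y‖)
      (fun n => (hφm n).aestronglyMeasurable.smul hv.aestronglyMeasurable)
      (integrable_smul_of_memLp (memLp_hermiteProd ν) hv).norm (fun n => ae_of_all _ fun y => ?_)
      (ae_of_all _ fun y => ?_)
    · rw [norm_smul, norm_smul, hermiteProd_eq_prod hνs]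
      gcongr
      simp only [hφ]
      rw [norm_prod, norm_prod]
      refine Finset.prod_le_prod (fun _ _ => norm_nonneg _) fun i _ => ?_
      rw [norm_mul]
      exact mul_le_of_le_one_left (norm_nonneg _) (abs_cutoff_le n _)
    · refine Tendsto.smul_const ?_ _
      rw [hermiteProd_eq_prod hνs]
      refine tendsto_finsetProd _ fun i _ => ?_
      simpa using (tendsto_cutoff (y i)).mul_const (hermiteFun (ν i) (y i))
  have hKt : Tendsto (fun n => ∫ y, K n y • u y ∂(gaussProd ι)) atTop
      (𝓝 (∫ y, (√(ν j + 1 : ℝ) * hermiteProd (ν + Finsupp.single j 1) y) • u y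
        ∂(gaussProd ι))) := by
    have hi1 := integrable_smul_of_memLp
      ((memLp_hermiteProd (ν + Finsupp.single j 1)).const_mul √(ν j + 1 : ℝ)) hu
    have hi2 := integrable_smul_of_memLp ((memLp_hermiteProd ν).const_mul C) hu
    refine tendsto_integral_of_dominated_convergence
      (fun y => ‖(√(ν j + 1 : ℝ) * hermiteProd (ν + Finsupp.single j 1) y) • u y‖ +
        ‖(C * hermiteProd ν y) • u y‖)
      (fun n => (hKm n).aestronglyMeasurable.smul hu.aestronglyMeasurable)
      (hi1.norm.add hi2.norm) (fun n => ae_of_all _ fun y => ?_) (ae_of_all _ fun y => ?_)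
    · rw [norm_smul, norm_smul, norm_smul, ← add_mul]
      gcongr
      have h0 : ‖√(ν j + 1 : ℝ) * hermiteProd (ν + Finsupp.single j 1) y‖ + ‖C * hermiteProd ν y‖ =
          (‖√(ν j + 1 : ℝ) * hermiteFun (ν j + 1) (y j)‖ + ‖C * hermiteFun (ν j) (y j)‖) *
            ‖∏ i ∈ s.erase j, hermiteFun (ν i) (y i)‖ := by
        rw [hermiteProd_add_single ν j s hνs hjs, hermiteProd_eq_prod hνs,
          ← Finset.mul_prod_erase s _ hjs]
        simp only [norm_mul]
        ring
      have h1 : ‖∏ i ∈ s.erase j, cutoff n (y i) * hermiteFun (ν i) (y i)‖ ≤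
          ‖∏ i ∈ s.erase j, hermiteFun (ν i) (y i)‖ := by
        rw [norm_prod, norm_prod]
        refine Finset.prod_le_prod (fun _ _ => norm_nonneg _) fun i _ => ?_
        rw [norm_mul]
        exact mul_le_of_le_one_left (norm_nonneg _) (abs_cutoff_le n _)
      have h2 : ‖cutoff n (y j) * (√(ν j + 1 : ℝ) * hermiteFun (ν j + 1) (y j)) -
          cutoffDeriv n (y j) * hermiteFun (ν j) (y j)‖ ≤
          ‖√(ν j + 1 : ℝ) * hermiteFun (ν j + 1) (y j)‖ + ‖C * hermiteFun (ν j) (y j)‖ := by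
        refine (norm_sub_le _ _).trans (add_le_add ?_ ?_)
        · rw [norm_mul (cutoff n (y j))]
          exact mul_le_of_le_one_left (norm_nonneg _) (abs_cutoff_le n _)
        · rw [norm_mul, norm_mul]
          gcongr
          rw [Real.norm_of_nonneg hC0]
          exact (hC n _).2
      rw [h0]
      exact (norm_mul_le _ _).trans (mul_le_mul h2 h1 (norm_nonneg _) (by positivity))
    · refine Tendsto.smul_const ?_ _
      rw [hermiteProd_add_single ν j s hνs hjs, ← mul_assoc]
      refine Tendsto.mul ?_ ?_
      · have := ((tendsto_cutoff (y j)).mul_const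
          (√(ν j + 1 : ℝ) * hermiteFun (ν j + 1) (y j))).sub
          ((tendsto_cutoffDeriv (y j)).mul_const (hermiteFun (ν j) (y j)))
        simpa using this
      · refine tendsto_finsetProd _ fun i _ => ?_
        simpa using (tendsto_cutoff (y i)).mul_const (hermiteFun (ν i) (y i))
  rw [tendsto_nhds_unique hφt (hKt.congr hweak), ← integral_smul]
  simp only [smul_smul]

variable [CompleteSpace S]

/-! ### Hermite coefficients and the energy -/

/-- `∏_j λ_j (λ_j - 1) ⋯ (λ_j - μ_j + 1)`. -/
def descProd (μ lam : ι →₀ ℕ) : ℝ := μ.prod fun j k => ((lam j).descFactorial k : ℝ)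

/-- Raising `μ_j` by one adds the factor `λ_j - μ_j` to the falling factorial, and at `λ = ν + μ +
e_j` this is the `ν_j + 1` produced by one integration by parts. -/
theorem descProd_add_single (μ ν : ι →₀ ℕ) (j : ι) :
    descProd (μ + Finsupp.single j 1) (ν + (μ + Finsupp.single j 1)) =
      (ν j + 1 : ℝ) * descProd μ (ν + (μ + Finsupp.single j 1)) := by
  classical
  set s : Finset ι := insert j μ.support with hs
  have hjs : j ∈ s := Finset.mem_insert_self _ _
  have hsub : (μ + Finsupp.single j 1).support ⊆ s := by
    refine Finsupp.support_add.trans (Finset.union_subset (Finset.subset_insert _ _) ?_)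
    exact Finsupp.support_single_subset.trans (Finset.singleton_subset_iff.2 hjs)
  set lam := ν + (μ + Finsupp.single j 1) with hlam
  rw [descProd, descProd,
    finsupp_prod_eq_prod (f := fun j k => ((lam j).descFactorial k : ℝ)) (by simp) hsub,
    finsupp_prod_eq_prod (f := fun j k => ((lam j).descFactorial k : ℝ)) (by simp)
      (Finset.subset_insert j μ.support), ← hs, ← Finset.mul_prod_erase s _ hjs,
    ← Finset.mul_prod_erase s (fun i => ((lam i).descFactorial (μ i) : ℝ)) hjs, ← mul_assoc]
  congr 1
  · have h1 : lam j - μ j = ν j + 1 := by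
      simp only [hlam, Finsupp.add_apply, Finsupp.single_eq_same]
      omega
    simp only [Finsupp.add_apply, Finsupp.single_eq_same]
    rw [Nat.descFactorial_succ, h1]
    push_cast
    ring
  · refine Finset.prod_congr rfl fun i hi => ?_
    simp [Finsupp.single_eq_of_ne (Finset.ne_of_mem_erase hi)]

variable {τ : ι → ℝ} {r : ℕ} {f : (ι → ℝ) → S} {D : (ι →₀ ℕ) → (ι → ℝ) → S}

theorem integral_hermiteProd_mul_clm (L : S →L[ℝ] ℝ) {u : (ι → ℝ) → S}
    (hu : MemLp u 2 (gaussProd ι)) (ν : ι →₀ ℕ) :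
    ∫ y, hermiteProd ν y * L (u y) ∂(gaussProd ι) =
      L (∫ y, hermiteProd ν y • u y ∂(gaussProd ι)) := by
  rw [← L.integral_comp_comm (integrable_smul_of_memLp (memLp_hermiteProd ν) hu)]
  simp

/-- Each integration by parts removes one derivative and raises the Hermite index by one, so
induction on the order of `μ` applies. Squaring turns the factors `√(ν_j + 1)` into a falling
factorial. -/
theorem HasMixedDerivs.sq_integral_hermiteProd (hD : HasMixedDerivs τ r f D) (L : S →L[ℝ] ℝ)
    (μ : ι →₀ ℕ) (hμ : ∀ i, μ i ≤ r) (ν : ι →₀ ℕ) :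
    (∫ y, hermiteProd ν y * L (D μ y) ∂(gaussProd ι)) ^ 2 =
      descProd μ (ν + μ) * (∫ y, hermiteProd (ν + μ) y * L (f y) ∂(gaussProd ι)) ^ 2 := by
  induction hn : μ.degree generalizing μ ν with
  | zero =>
    rw [Finsupp.degree_eq_zero_iff] at hn
    subst hn
    simp [hD.zero, descProd]
  | succ n ih =>
    have hne : μ ≠ 0 := by
      rintro rfl
      simp at hn
    obtain ⟨j, hj⟩ := Finsupp.ne_iff.1 hne
    have hj1 : Finsupp.single j 1 ≤ μ := by
      rw [Finsupp.single_le_iff]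
      exact Nat.one_le_iff_ne_zero.2 hj
    obtain ⟨μ', rfl⟩ : ∃ μ', μ = μ' + Finsupp.single j 1 :=
      ⟨μ - Finsupp.single j 1, (tsub_add_cancel_of_le hj1).symm⟩
    have hμ' : ∀ i, μ' i ≤ r := fun i => (Nat.le_add_right _ _).trans (hμ i)
    have hdeg : μ'.degree = n := by
      rw [map_add, Finsupp.degree_single] at hn
      omega
    have hw := (hD.succ μ' j hμ).integral_hermiteProd (hD.memLp _ hμ') (hD.memLp _ hμ) ν
    rw [integral_hermiteProd_mul_clm L (hD.memLp _ hμ), hw, map_smul, smul_eq_mul, mul_pow,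
      Real.sq_sqrt (by positivity), ← integral_hermiteProd_mul_clm L (hD.memLp _ hμ'),
      ih μ' hμ' (ν + Finsupp.single j 1) hdeg, descProd_add_single,
      show ν + Finsupp.single j 1 + μ' = ν + (μ' + Finsupp.single j 1) by abel]
    ring

theorem descProd_eq_zero {μ lam : ι →₀ ℕ} (h : ¬ μ ≤ lam) : descProd μ lam = 0 := by
  rw [Finsupp.le_def, not_forall] at h
  obtain ⟨j, hj⟩ := h
  rw [not_le] at hj
  refine Finset.prod_eq_zero (i := j) (Finsupp.mem_support_iff.2 (by omega)) ?_
  simp only [Nat.descFactorial_eq_zero_iff_lt.2 hj, Nat.cast_zero]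

/-- Bessel's inequality for a mixed derivative, in terms of the Hermite coefficients of `f`. -/
theorem HasMixedDerivs.sum_descProd_mul_sq_le (hD : HasMixedDerivs τ r f D) {L : S →L[ℝ] ℝ}
    (hL : ‖L‖ ≤ 1) (μ : ι →₀ ℕ) (hμ : ∀ i, μ i ≤ r) (T : Finset (ι →₀ ℕ)) :
    ∑ lam ∈ T, descProd μ lam * (∫ y, hermiteProd lam y * L (f y) ∂(gaussProd ι)) ^ 2 ≤
      ∫ y, ‖D μ y‖ ^ 2 ∂(gaussProd ι) := by
  classical
  set x : (ι →₀ ℕ) → ℝ := fun lam => ∫ y, hermiteProd lam y * L (f y) ∂(gaussProd ι) with hx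
  have hLD := L.comp_memLp' (hD.memLp μ hμ)
  calc ∑ lam ∈ T, descProd μ lam * x lam ^ 2
      = ∑ lam ∈ T with μ ≤ lam, descProd μ lam * x lam ^ 2 := by
        rw [Finset.sum_filter]
        refine Finset.sum_congr rfl fun lam _ => ?_
        split_ifs with h
        · rfl
        · rw [descProd_eq_zero h, zero_mul]
    _ = ∑ ν ∈ (T.filter (μ ≤ ·)).image (· - μ),
          (∫ y, hermiteProd ν y * L (D μ y) ∂(gaussProd ι)) ^ 2 := by
        rw [Finset.sum_image]
        · refine Finset.sum_congr rfl fun lam hlam => ?_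
          rw [hD.sq_integral_hermiteProd L μ hμ, tsub_add_cancel_of_le (Finset.mem_filter.1 hlam).2]
        · intro a ha b hb hab
          have ha' := (Finset.mem_filter.1 ha).2
          have hb' := (Finset.mem_filter.1 hb).2
          rw [← tsub_add_cancel_of_le ha', ← tsub_add_cancel_of_le hb']
          exact congrArg (· + μ) hab
    _ ≤ ∫ y, (L (D μ y)) ^ 2 ∂(gaussProd ι) := sum_sq_integral_hermiteProd_le hLD _
    _ ≤ ∫ y, ‖D μ y‖ ^ 2 ∂(gaussProd ι) := by
        refine integral_mono hLD.integrable_sq (hD.memLp μ hμ).norm.integrable_sq fun y => ?_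
        have h1 : ‖L (D μ y)‖ ≤ ‖D μ y‖ := by
          refine (L.le_opNorm _).trans (mul_le_of_le_one_left (norm_nonneg _) hL)
        simp only
        rw [← sq_abs]
        exact pow_le_pow_left₀ (abs_nonneg _) h1 2

theorem summable_bWeight (τ : ι → ℝ) (r : ℕ) (lam : ι →₀ ℕ) :
    Summable fun μ : BddIndex ι r =>
      μ.1.prod fun j k => ((lam j).choose k : ℝ) * τ j ^ (2 * k) := by
  classical
  refine summable_of_hasFiniteSupport ?_
  refine ((Finset.finite_toSet (lam.support.finsupp fun j => Finset.range (lam j + 1))).preimage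
    Subtype.val_injective.injOn).subset fun μ hμ => ?_
  have hle : ∀ j, μ.1 j ≤ lam j := by
    intro j
    by_contra hj
    rw [not_le] at hj
    refine hμ (Finset.prod_eq_zero (i := j) (Finsupp.mem_support_iff.2 (by omega)) ?_)
    simp only [Nat.choose_eq_zero_of_lt hj, Nat.cast_zero, zero_mul]
  rw [Set.mem_preimage, Finset.mem_coe, Finset.mem_finsupp_iff]
  refine ⟨fun j hj => ?_, fun j _ => Finset.mem_range.2 (Nat.lt_succ_of_le (hle j))⟩
  rw [Finsupp.mem_support_iff] at hj ⊢
  have := hle j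
  omega

/-- The weighted sum of the squared Hermite coefficients is bounded by the energy. -/
theorem HasMixedDerivs.sum_bWeight_mul_sq_le (hD : HasMixedDerivs τ r f D) {L : S →L[ℝ] ℝ}
    (hτ : ∀ j, 0 < τ j) (hL : ‖L‖ ≤ 1) (T : Finset (ι →₀ ℕ)) :
    ∑ lam ∈ T, bWeight τ r lam * (∫ y, hermiteProd lam y * L (f y) ∂(gaussProd ι)) ^ 2 ≤
      energy τ r D := by
  set x : (ι →₀ ℕ) → ℝ := fun lam => ∫ y, hermiteProd lam y * L (f y) ∂(gaussProd ι) with hx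
  have hs : ∀ lam ∈ T, Summable fun μ : BddIndex ι r =>
      (μ.1.prod fun j k => ((lam j).choose k : ℝ) * τ j ^ (2 * k)) * x lam ^ 2 :=
    fun lam _ => (summable_bWeight τ r lam).mul_right _
  simp only [bWeight, ← tsum_mul_right]
  rw [← Summable.tsum_finsetSum hs]
  refine Summable.tsum_le_tsum (fun μ => ?_) (summable_sum hs) hD.summable
  -- Binomials are falling factorials over `μ!`, so after exchanging the sums each `μ` contributes
  -- its energy weight times the left side of Bessel's inequality for `∂^μ f`.
  have e : ∀ lam : ι →₀ ℕ, (μ.1.prod fun j k => ((lam j).choose k : ℝ) * τ j ^ (2 * k)) =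
      (μ.1.prod fun j k => τ j ^ (2 * k) / (k.factorial : ℝ)) * descProd μ.1 lam := by
    intro lam
    rw [descProd, ← Finsupp.prod_mul]
    refine Finsupp.prod_congr fun j _ => ?_
    rw [Nat.descFactorial_eq_factorial_mul_choose]
    have := (μ.1 j).factorial_pos
    push_cast
    field_simp
  simp only [e, mul_assoc]
  rw [← Finset.mul_sum, energyTerm]
  refine mul_le_mul_of_nonneg_left (hD.sum_descProd_mul_sq_le hL μ.1 μ.2 T) ?_
  exact Finset.prod_nonneg fun j _ => div_nonneg (pow_nonneg (hτ j).le _) (Nat.cast_nonneg _)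

end Vector

/-! ### The weights `b_ν` -/

/-- The univariate factor `∑_{k ≤ r} binom(n, k) t^{2k}` of `b_ν`. -/
def bFactor (r : ℕ) (t : ℝ) (n : ℕ) : ℝ :=
  ∑ k ∈ Finset.range (r + 1), (n.choose k : ℝ) * t ^ (2 * k)

theorem bFactor_zero (r : ℕ) (t : ℝ) : bFactor r t 0 = 1 := by
  rw [bFactor, Finset.sum_range_succ']
  simp

theorem bFactor_mono {r : ℕ} {t : ℝ} (ht : 0 < t) : Monotone (bFactor r t) := by
  intro m n hmn
  refine Finset.sum_le_sum fun k _ => ?_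
  have := Nat.choose_le_choose k hmn
  gcongr

theorem bFactor_strictMono {r : ℕ} (hr : 1 ≤ r) {t : ℝ} (ht : 0 < t) :
    StrictMono (bFactor r t) := by
  intro m n hmn
  refine Finset.sum_lt_sum (fun k _ => ?_) ⟨1, Finset.mem_range.2 (by omega), ?_⟩
  · have := Nat.choose_le_choose k hmn.le
    gcongr
  · rw [Nat.choose_one_right, Nat.choose_one_right]
    have : (m : ℝ) < n := by exact_mod_cast hmn
    gcongr

theorem one_le_bFactor {r : ℕ} {t : ℝ} (ht : 0 < t) (n : ℕ) : 1 ≤ bFactor r t n := by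
  rw [← bFactor_zero r t]
  exact bFactor_mono ht (Nat.zero_le n)

section General

variable {τ : ι → ℝ} {r : ℕ}

/-- Only `μ` supported in `supp ν` contribute, and over these the distributive law factorises the
sum. -/
theorem bWeight_eq_prod (τ : ι → ℝ) (r : ℕ) (ν : ι →₀ ℕ) :
    bWeight τ r ν = ν.prod fun j n => bFactor r (τ j) n := by
  classical
  set F : (ι →₀ ℕ) → ℝ := fun μ => μ.prod fun j k => ((ν j).choose k : ℝ) * τ j ^ (2 * k) with hF
  set T : Finset (ι →₀ ℕ) := ν.support.finsupp fun _ => Finset.range (r + 1) with hT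
  have hmem : ∀ μ : ι →₀ ℕ, (∀ j, μ j ≤ r) → μ ∉ T → F μ = 0 := by
    intro μ hμ hμT
    obtain ⟨j, hj, hjν⟩ : ∃ j ∈ μ.support, j ∉ ν.support := by
      by_contra! h
      exact hμT (Finset.mem_finsupp_iff.2
        ⟨h, fun j _ => Finset.mem_range.2 (Nat.lt_succ_of_le (hμ j))⟩)
    refine Finset.prod_eq_zero hj ?_
    rw [Finsupp.mem_support_iff] at hj
    rw [Finsupp.notMem_support_iff] at hjν
    simp only [hjν, Nat.choose_eq_zero_of_lt (Nat.pos_of_ne_zero hj), Nat.cast_zero, zero_mul]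
  have hle : ∀ μ ∈ T, ∀ j, μ j ≤ r := by
    intro μ hμ j
    obtain ⟨h1, h2⟩ := Finset.mem_finsupp_iff.1 hμ
    by_cases hj : j ∈ ν.support
    · exact Nat.lt_succ_iff.1 (Finset.mem_range.1 (h2 j hj))
    · rw [Finsupp.notMem_support_iff.1 fun h => hj (h1 h)]
      exact Nat.zero_le _
  have h1 : bWeight τ r ν = ∑ μ ∈ T, F μ := by
    rw [← Finset.sum_subtype_of_mem F hle]
    refine tsum_eq_sum fun μ hμ => ?_
    rw [Finset.mem_subtype] at hμ
    exact hmem μ.1 μ.2 hμ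
  rw [h1, Finsupp.prod]
  simp only [bFactor]
  rw [← sum_finsupp_prod ν.support (fun _ => Finset.range (r + 1))
    (fun j k => ((ν j).choose k : ℝ) * τ j ^ (2 * k))]
  refine Finset.sum_congr rfl fun μ hμ => ?_
  exact finsupp_prod_eq_prod (by simp) (Finset.mem_finsupp_iff.1 hμ).1

theorem one_le_bWeight (hτ : ∀ j, 0 < τ j) (ν : ι →₀ ℕ) : 1 ≤ bWeight τ r ν := by
  rw [bWeight_eq_prod]
  exact Finset.prod_induction _ (1 ≤ ·) (fun _ _ => one_le_mul_of_one_le_of_one_le) le_rfl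
    fun j _ => one_le_bFactor (hτ j) _

/-- The term `k = 1`, equal to `n t²`, makes each univariate factor strictly increasing. Strictness
ensures that every choice of smallest indices, however ties are broken, is admissible. -/
theorem bWeight_lt_bWeight (hr : 1 ≤ r) (hτ : ∀ j, 0 < τ j) {μ ν : ι →₀ ℕ} (hle : ∀ j, μ j ≤ ν j)
    (hne : μ ≠ ν) : bWeight τ r μ < bWeight τ r ν := by
  classical
  have hsub : μ.support ⊆ ν.support := by
    intro j hj
    rw [Finsupp.mem_support_iff] at hj ⊢
    have := hle j
    omega
  rw [bWeight_eq_prod, bWeight_eq_prod, finsupp_prod_eq_prod (fun j => bFactor_zero r (τ j)) hsub,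
    Finsupp.prod]
  obtain ⟨j, hj⟩ : ∃ j, μ j ≠ ν j := by
    by_contra! h
    exact hne (Finsupp.ext h)
  have hlt : μ j < ν j := lt_of_le_of_ne (hle j) hj
  refine Finset.prod_lt_prod (fun i _ => zero_lt_one.trans_le (one_le_bFactor (hτ i) _))
    (fun i _ => bFactor_mono (hτ i) (hle i)) ⟨j, Finsupp.mem_support_iff.2 (by omega), ?_⟩
  exact bFactor_strictMono hr (hτ j) hlt

theorem IsNSmallest.admissible (hr : 1 ≤ r) (hτ : ∀ j, 0 < τ j) {N : ℕ} {Λ : Finset (ι →₀ ℕ)}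
    (h : IsNSmallest (bWeight τ r) N Λ) : Admissible Λ := by
  intro ν hν μ hle
  by_contra hμ
  have hne : μ ≠ ν := by
    rintro rfl
    exact hμ hν
  exact absurd (h.2 ν hν μ hμ) (not_le.2 (bWeight_lt_bWeight hr hτ hle hne))

theorem exists_isNSmallest [Infinite (ι →₀ ℕ)] {b : (ι →₀ ℕ) → ℝ}
    (hb : ∀ c, {ν | b ν ≤ c}.Finite) (N : ℕ) : ∃ Λ, IsNSmallest b N Λ := by
  classical
  induction N with
  | zero => exact ⟨∅, rfl, by simp⟩
  | succ N ih =>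
    obtain ⟨Λ, hcard, hΛ⟩ := ih
    obtain ⟨ν₀, hν₀⟩ := Infinite.exists_notMem_finset Λ
    -- A minimiser of `b` off `Λ` exists because it may be sought in the finite sublevel set of some
    -- `ν₀ ∉ Λ`.
    obtain ⟨ν, hν, hmin⟩ := Finset.exists_min_image ((hb (b ν₀)).toFinset \ Λ) b
      ⟨ν₀, by simp [hν₀]⟩
    rw [Finset.mem_sdiff] at hν
    refine ⟨insert ν Λ, by rw [Finset.card_insert_of_notMem hν.2, hcard], ?_⟩
    intro lam hlam μ hμ
    rw [Finset.mem_insert, not_or] at hμ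
    rcases Finset.mem_insert.1 hlam with rfl | hlam
    · by_cases h : b μ ≤ b ν₀
      · exact hmin μ (by simp [h, hμ.2])
      · have h1 : b lam ≤ b ν₀ := by simpa using hν.1
        exact h1.trans (not_le.1 h).le
    · exact hΛ lam hlam μ hμ.2

/-- Sums of products over multi-indices are bounded by an infinite product. -/
theorem sum_finsupp_prod_le_exp {g : ι → ℕ → ℝ} (hg0 : ∀ j, g j 0 = 1) (hg : ∀ j n, 0 ≤ g j n)
    {A : ℝ} (hA : ∀ (s : Finset ι) (M : ℕ), ∑ j ∈ s, ∑ n ∈ Finset.range M, g j (n + 1) ≤ A)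
    (T : Finset (ι →₀ ℕ)) : ∑ ν ∈ T, ν.prod g ≤ Real.exp A := by
  classical
  set s : Finset ι := T.biUnion Finsupp.support with hs
  set M : ℕ := T.sup fun ν => s.sup ν with hM
  have hsub : T ⊆ s.finsupp fun _ => Finset.range (M + 1) := by
    intro ν hν
    refine Finset.mem_finsupp_iff.2 ⟨Finset.subset_biUnion_of_mem Finsupp.support hν, fun j hj => ?_⟩
    refine Finset.mem_range.2 (Nat.lt_succ_of_le ?_)
    exact (Finset.le_sup (f := ν) hj).trans (Finset.le_sup (f := fun ν : ι →₀ ℕ => s.sup ν) hν)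
  calc ∑ ν ∈ T, ν.prod g ≤ ∑ ν ∈ s.finsupp fun _ => Finset.range (M + 1), ν.prod g :=
        Finset.sum_le_sum_of_subset_of_nonneg hsub fun ν _ _ => Finset.prod_nonneg fun j _ => hg j _
    _ = ∑ ν ∈ s.finsupp fun _ => Finset.range (M + 1), ∏ j ∈ s, g j (ν j) :=
        Finset.sum_congr rfl fun ν hν =>
          finsupp_prod_eq_prod hg0 (Finset.mem_finsupp_iff.1 hν).1
    _ = ∏ j ∈ s, ∑ n ∈ Finset.range (M + 1), g j n := sum_finsupp_prod _ _ _
    _ ≤ ∏ j ∈ s, Real.exp (∑ n ∈ Finset.range M, g j (n + 1)) := by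
        refine Finset.prod_le_prod (fun j _ => Finset.sum_nonneg fun n _ => hg j n) fun j _ => ?_
        rw [Finset.sum_range_succ', hg0]
        exact Real.add_one_le_exp _
    _ = Real.exp (∑ j ∈ s, ∑ n ∈ Finset.range M, g j (n + 1)) := (Real.exp_sum _ _).symm
    _ ≤ Real.exp A := Real.exp_le_exp.2 (hA s M)

end General

/-! ### Summability of negative powers of the weights -/

/-- For `n < r` the term `k = 1` suffices, as `n^r` is then bounded. For `n ≥ r` the term `k = r`
does, by `n - r + 1 ≥ n / r`; of its power `t^{2r}` all but `t²` is bounded below through `t₀`. -/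
theorem exists_bFactor_lower {t₀ : ℝ} (ht₀ : 0 < t₀) {r : ℕ} (hr : 1 ≤ r) :
    ∃ c : ℝ, 0 < c ∧ ∀ t, t₀ ≤ t → ∀ n : ℕ, 1 ≤ n → c * ((n : ℝ) ^ r * t ^ 2) ≤ bFactor r t n := by
  have hr0 : (0 : ℝ) < r := by exact_mod_cast hr
  have hf : (0 : ℝ) < r.factorial := by exact_mod_cast r.factorial_pos
  refine ⟨((r : ℝ) ^ r)⁻¹ * min 1 (t₀ ^ (2 * (r - 1)) / r.factorial), by positivity, ?_⟩
  intro t ht n hn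
  have ht0 : 0 < t := ht₀.trans_le ht
  have hterm : ∀ k ∈ Finset.range (r + 1), (n.choose k : ℝ) * t ^ (2 * k) ≤ bFactor r t n :=
    fun k hk => Finset.single_le_sum (f := fun k => (n.choose k : ℝ) * t ^ (2 * k))
      (fun i _ => by positivity) hk
  rcases lt_or_ge n r with h | h
  · refine le_trans ?_ (hterm 1 (Finset.mem_range.2 (by omega)))
    rw [Nat.choose_one_right, mul_one]
    have h1 : (n : ℝ) ^ r ≤ (r : ℝ) ^ r := by gcongr
    have h2 : (1 : ℝ) ≤ n := by exact_mod_cast hn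
    calc ((r : ℝ) ^ r)⁻¹ * min 1 (t₀ ^ (2 * (r - 1)) / r.factorial) * ((n : ℝ) ^ r * t ^ 2)
        ≤ ((r : ℝ) ^ r)⁻¹ * 1 * ((r : ℝ) ^ r * t ^ 2) := by
          gcongr
          exact min_le_left _ _
      _ = 1 * t ^ 2 := by field_simp
      _ ≤ n * t ^ 2 := by gcongr
  · refine le_trans ?_ (hterm r (Finset.mem_range.2 (by omega)))
    have h1 : (n : ℝ) / r ≤ ((n + 1 - r : ℕ) : ℝ) := by
      rw [div_le_iff₀ hr0, Nat.cast_sub (by omega)]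
      push_cast
      have h2 : (r : ℝ) ≤ n := by exact_mod_cast h
      have h3 : (1 : ℝ) ≤ r := by exact_mod_cast hr
      nlinarith [mul_nonneg (sub_nonneg.2 h2) (sub_nonneg.2 h3)]
    have h2 : ((n : ℝ) / r) ^ r ≤ r.factorial * n.choose r := by
      refine (pow_le_pow_left₀ (by positivity) h1 r).trans ?_
      exact_mod_cast Nat.pow_sub_le_descFactorial n r |>.trans_eq
        (Nat.descFactorial_eq_factorial_mul_choose n r)
    have h3 : t ^ (2 * r) = t ^ (2 * (r - 1)) * t ^ 2 := by
      rw [← pow_add]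
      congr 1
      omega
    calc ((r : ℝ) ^ r)⁻¹ * min 1 (t₀ ^ (2 * (r - 1)) / r.factorial) * ((n : ℝ) ^ r * t ^ 2)
        ≤ ((r : ℝ) ^ r)⁻¹ * (t ^ (2 * (r - 1)) / r.factorial) * ((n : ℝ) ^ r * t ^ 2) := by
          gcongr
          refine (min_le_right _ _).trans ?_
          gcongr
      _ = ((n : ℝ) / r) ^ r * (t ^ (2 * (r - 1)) * t ^ 2) / r.factorial := by
          rw [div_pow]
          field_simp
      _ ≤ (r.factorial * n.choose r) * (t ^ (2 * (r - 1)) * t ^ 2) / r.factorial := by gcongr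
      _ = n.choose r * t ^ (2 * r) := by
          rw [h3]
          field_simp

/-- The summand `∏_j c² (1 + 4 ν_j)² b_{ν_j}^{-q/2}` that controls both the Hermite expansion and
the quadrature error. -/
def majorant {ι : Type*} (q : ℝ) (τ : ι → ℝ) (r : ℕ) (ν : ι →₀ ℕ) : ℝ :=
  (centredBound ^ ν.support.card) ^ 2 * (ν.prod fun _ n => (1 + 4 * n : ℝ)) ^ 2 *
    bWeight τ r ν ^ (-(q / 2))

theorem majorant_eq_prod {ι : Type*} (q : ℝ) {τ : ι → ℝ} (hτ : ∀ j, 0 < τ j) (r : ℕ)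
    (ν : ι →₀ ℕ) :
    majorant q τ r ν = ν.prod fun j n => if n = 0 then 1 else
      centredBound ^ 2 * (1 + 4 * n : ℝ) ^ 2 * bFactor r (τ j) n ^ (-(q / 2)) := by
  rw [majorant, bWeight_eq_prod]
  simp only [Finsupp.prod]
  rw [← Real.finsetProd_rpow _ _ fun j _ => zero_le_one.trans (one_le_bFactor (hτ j) _),
    ← Finset.prod_const, ← Finset.prod_pow, ← Finset.prod_pow, ← Finset.prod_mul_distrib,
    ← Finset.prod_mul_distrib]
  refine Finset.prod_congr rfl fun j hj => ?_
  rw [if_neg (Finsupp.mem_support_iff.1 hj)]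

theorem exists_lower_bound_of_summable {q : ℝ} (hq : 0 < q) {τ : ℕ → ℝ} (hτ : ∀ j, 0 < τ j)
    (hτq : Summable fun j => (τ j)⁻¹ ^ q) : ∃ t₀, 0 < t₀ ∧ ∀ j, t₀ ≤ τ j := by
  have hpos : ∀ j, 0 < (τ j)⁻¹ ^ q := fun j => Real.rpow_pos_of_pos (inv_pos.2 (hτ j)) q
  have hS : 0 < ∑' j, (τ j)⁻¹ ^ q := hτq.tsum_pos (fun j => (hpos j).le) 0 (hpos 0)
  refine ⟨((∑' j, (τ j)⁻¹ ^ q) ^ (1 / q))⁻¹, by positivity, fun j => ?_⟩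
  have h1 : (τ j)⁻¹ ^ q ≤ ∑' j, (τ j)⁻¹ ^ q := hτq.le_tsum j fun i _ => (hpos i).le
  have h2 : (τ j)⁻¹ ≤ (∑' j, (τ j)⁻¹ ^ q) ^ (1 / q) := by
    have := Real.rpow_le_rpow (hpos j).le h1 (by positivity : 0 ≤ 1 / q)
    rwa [← Real.rpow_mul (inv_nonneg.2 (hτ j).le), mul_one_div_cancel hq.ne', Real.rpow_one] at this
  exact inv_le_of_inv_le₀ (hτ j) h2

/-- In coordinate `j` the terms with `n ≥ 1` are of order `τ_j^{-q} n² n^{-rq/2}`, and `rq ≥ 8`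
leaves `τ_j^{-q} n^{-2}`, summable in `j` and `n`. The bound is independent of `J` because the
coordinates form a subset of `ℕ`. -/
theorem exists_sum_majorant_le {q : ℝ} (hq : 0 < q) {τ : ℕ → ℝ} (hτ : ∀ j, 0 < τ j)
    (hτq : Summable fun j => (τ j)⁻¹ ^ q) {r : ℕ} (hr : 8 / q ≤ r) (hr1 : 1 ≤ r) :
    ∃ A : ℝ, 0 < A ∧ ∀ (J : ℕ∞) (T : Finset (Coord J →₀ ℕ)),
      ∑ ν ∈ T, majorant q (fun j : Coord J => τ j) r ν ≤ A := by
  obtain ⟨t₀, ht₀, hτ₀⟩ := exists_lower_bound_of_summable hq hτ hτq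
  obtain ⟨c, hc, hb⟩ := exists_bFactor_lower ht₀ hr1
  have hcb : 0 < centredBound := zero_lt_one.trans_le one_le_centredBound
  -- The `25` comes from `1 + 4 m ≤ 5 m` for `m ≥ 1`.
  set K : ℝ := centredBound ^ 2 * 25 * c ^ (-(q / 2)) with hK
  have hK0 : 0 < K := by positivity
  have hterm : ∀ j (n : ℕ), centredBound ^ 2 * (1 + 4 * ((n + 1 : ℕ) : ℝ)) ^ 2 *
      bFactor r (τ j) (n + 1) ^ (-(q / 2)) ≤ K * (τ j)⁻¹ ^ q * (1 / ((n : ℝ) + 1) ^ 2) := by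
    intro j n
    set m : ℝ := ((n + 1 : ℕ) : ℝ) with hm
    have hm1 : 1 ≤ m := by
      rw [hm]
      push_cast
      linarith [Nat.cast_nonneg (α := ℝ) n]
    have hm0 : 0 < m := by linarith
    have hτj := hτ j
    have h1 : bFactor r (τ j) (n + 1) ^ (-(q / 2)) ≤
        c ^ (-(q / 2)) * (1 / m ^ 4) * (τ j)⁻¹ ^ q := by
      calc bFactor r (τ j) (n + 1) ^ (-(q / 2))
          ≤ (c * (m ^ r * τ j ^ 2)) ^ (-(q / 2)) :=
            Real.rpow_le_rpow_of_nonpos (by positivity) (hb _ (hτ₀ j) _ (by omega))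
              (by linarith)
        _ = c ^ (-(q / 2)) * ((m ^ r) ^ (-(q / 2)) * (τ j)⁻¹ ^ q) := by
            rw [Real.mul_rpow hc.le (by positivity), Real.mul_rpow (by positivity) (by positivity)]
            congr 2
            rw [Real.inv_rpow hτj.le, ← Real.rpow_neg hτj.le, ← Real.rpow_natCast (τ j) 2,
              ← Real.rpow_mul hτj.le]
            congr 1
            push_cast
            ring
        _ ≤ c ^ (-(q / 2)) * ((1 / m ^ 4) * (τ j)⁻¹ ^ q) := by
            have h2 : (m ^ r) ^ (-(q / 2)) ≤ 1 / m ^ 4 := by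
              rw [← Real.rpow_natCast m r, ← Real.rpow_mul hm0.le, one_div,
                ← Real.rpow_natCast m 4, ← Real.rpow_neg hm0.le]
              refine Real.rpow_le_rpow_of_exponent_le hm1 ?_
              rw [div_le_iff₀ hq] at hr
              push_cast
              nlinarith
            have : 0 ≤ (τ j)⁻¹ ^ q := Real.rpow_nonneg (inv_nonneg.2 hτj.le) q
            gcongr
        _ = _ := by ring
    have h3 : (1 + 4 * m) ^ 2 ≤ 25 * m ^ 2 := by nlinarith
    have h4 : (0 : ℝ) ≤ (τ j)⁻¹ ^ q := Real.rpow_nonneg (inv_nonneg.2 hτj.le) q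
    have h5 : (n : ℝ) + 1 = m := by rw [hm]; push_cast; rfl
    rw [h5]
    calc centredBound ^ 2 * (1 + 4 * m) ^ 2 * bFactor r (τ j) (n + 1) ^ (-(q / 2))
        ≤ centredBound ^ 2 * (25 * m ^ 2) * (c ^ (-(q / 2)) * (1 / m ^ 4) * (τ j)⁻¹ ^ q) := by
          have := zero_le_one.trans (one_le_bFactor (r := r) hτj (n + 1))
          gcongr
      _ = K * (τ j)⁻¹ ^ q * (1 / m ^ 2) := by
          rw [hK]
          field_simp
  have hs2 : Summable fun n : ℕ => 1 / ((n : ℝ) + 1) ^ 2 := by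
    have := (summable_nat_add_iff 1).2 (Real.summable_one_div_nat_pow.2 one_lt_two)
    exact_mod_cast this
  refine ⟨Real.exp (K * (∑' j, (τ j)⁻¹ ^ q) * ∑' n : ℕ, 1 / ((n : ℝ) + 1) ^ 2), Real.exp_pos _,
    fun J T => ?_⟩
  simp only [majorant_eq_prod q (τ := fun j : Coord J => τ j) (fun j => hτ j) r]
  refine sum_finsupp_prod_le_exp (g := fun (j : Coord J) n => if n = 0 then 1 else
      centredBound ^ 2 * (1 + 4 * n : ℝ) ^ 2 * bFactor r (τ j) n ^ (-(q / 2)))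
    (fun j => if_pos rfl) (fun j n => ?_) (fun s M => ?_) T
  · split_ifs
    · exact zero_le_one
    · have := zero_le_one.trans (one_le_bFactor (r := r) (hτ j) n)
      positivity
  · simp only [Nat.succ_ne_zero, if_false]
    have hnn : ∀ j, 0 ≤ (τ j)⁻¹ ^ q := fun j => Real.rpow_nonneg (inv_nonneg.2 (hτ j).le) q
    calc ∑ j ∈ s, ∑ n ∈ Finset.range M, centredBound ^ 2 * (1 + 4 * ((n + 1 : ℕ) : ℝ)) ^ 2 *
            bFactor r (τ j) (n + 1) ^ (-(q / 2))
        ≤ ∑ j ∈ s, ∑ n ∈ Finset.range M, K * (τ j)⁻¹ ^ q * (1 / ((n : ℝ) + 1) ^ 2) :=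
          Finset.sum_le_sum fun j _ => Finset.sum_le_sum fun n _ => hterm j n
      _ = K * (∑ j ∈ s, (τ j)⁻¹ ^ q) * ∑ n ∈ Finset.range M, 1 / ((n : ℝ) + 1) ^ 2 := by
          rw [Finset.mul_sum s, Finset.sum_mul]
          exact Finset.sum_congr rfl fun j _ => (Finset.mul_sum _ _ _).symm
      _ ≤ K * (∑' j, (τ j)⁻¹ ^ q) * ∑' n : ℕ, 1 / ((n : ℝ) + 1) ^ 2 := by
          have h1 : ∑ j ∈ s, (τ j)⁻¹ ^ q ≤ ∑' j, (τ j)⁻¹ ^ q := by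
            have := hτq.sum_le_tsum (s.map (Function.Embedding.subtype _)) fun j _ => hnn j
            rwa [Finset.sum_map] at this
          have h2 : ∑ n ∈ Finset.range M, 1 / ((n : ℝ) + 1) ^ 2 ≤
              ∑' n : ℕ, 1 / ((n : ℝ) + 1) ^ 2 :=
            hs2.sum_le_tsum _ fun n _ => by positivity
          have h3 : 0 ≤ ∑' j, (τ j)⁻¹ ^ q := tsum_nonneg hnn
          gcongr

/-! ### Sublevel sets and tails of the weights -/

section Consequences

variable {q : ℝ} {τ : ι → ℝ} {r : ℕ} {A : ℝ}

theorem one_le_prod_one_add (ν : ι →₀ ℕ) : 1 ≤ ν.prod fun _ n => (1 + 4 * n : ℝ) :=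
  Finset.prod_induction _ (1 ≤ ·) (fun _ _ => one_le_mul_of_one_le_of_one_le) le_rfl
    fun j _ => by linarith [Nat.cast_nonneg (α := ℝ) (ν j)]

theorem bWeight_rpow_le_majorant (q : ℝ) (hτ : ∀ j, 0 < τ j) (ν : ι →₀ ℕ) :
    bWeight τ r ν ^ (-(q / 2)) ≤ majorant q τ r ν := by
  have hb := zero_le_one.trans (one_le_bWeight (r := r) hτ ν)
  refine le_mul_of_one_le_left (Real.rpow_nonneg hb _) ?_
  exact one_le_mul_of_one_le_of_one_le (one_le_pow₀ (one_le_pow₀ one_le_centredBound))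
    (one_le_pow₀ (one_le_prod_one_add ν))

/-- Every index in the sublevel set adds at least `c^{-q/2}` to a sum bounded by `A`. -/
theorem finite_bWeight_le (hq : 0 < q) (hτ : ∀ j, 0 < τ j)
    (hA : ∀ T : Finset (ι →₀ ℕ), ∑ ν ∈ T, majorant q τ r ν ≤ A) (c : ℝ) :
    {ν | bWeight τ r ν ≤ c}.Finite := by
  by_contra hinf
  have h1 : ∀ ν ∈ {ν | bWeight τ r ν ≤ c}, c ^ (-(q / 2)) ≤ bWeight τ r ν ^ (-(q / 2)) := by
    intro ν hν
    exact Real.rpow_le_rpow_of_nonpos (zero_lt_one.trans_le (one_le_bWeight hτ ν)) hν (by linarith)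
  obtain ⟨ν₀, hν₀⟩ := Set.Infinite.nonempty hinf
  have hc : 0 < c := (zero_lt_one.trans_le (one_le_bWeight hτ ν₀)).trans_le hν₀
  have hcp : 0 < c ^ (-(q / 2)) := Real.rpow_pos_of_pos hc _
  obtain ⟨n, hn⟩ := exists_nat_gt (A / c ^ (-(q / 2)))
  obtain ⟨T, hT, hcard⟩ := Set.Infinite.exists_subset_card_eq hinf n
  have h2 : (n : ℝ) * c ^ (-(q / 2)) ≤ A := by
    calc (n : ℝ) * c ^ (-(q / 2)) = ∑ ν ∈ T, c ^ (-(q / 2)) := by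
          rw [Finset.sum_const, hcard, nsmul_eq_mul]
      _ ≤ ∑ ν ∈ T, majorant q τ r ν :=
          Finset.sum_le_sum fun ν hν => (h1 ν (hT hν)).trans (bWeight_rpow_le_majorant q hτ ν)
      _ ≤ A := hA T
  rw [div_lt_iff₀ hcp] at hn
  linarith

/-- Stechkin's argument: outside the `N` smallest indices the weights are large. -/
theorem IsNSmallest.bWeight_rpow_le (hq : 0 < q) (hτ : ∀ j, 0 < τ j)
    (hA : ∀ T : Finset (ι →₀ ℕ), ∑ ν ∈ T, majorant q τ r ν ≤ A) {N : ℕ} {Λ : Finset (ι →₀ ℕ)}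
    (hΛ : IsNSmallest (bWeight τ r) N Λ) {ν : ι →₀ ℕ} (hν : ν ∉ Λ) :
    bWeight τ r ν ^ (-(q / 2)) ≤ A / (N + 1) := by
  classical
  rw [le_div_iff₀ (by positivity)]
  -- Counting `ν` itself along with `Λ` gives `N + 1` rather than `N`, so the bound makes sense for
  -- `N = 0` too.
  calc bWeight τ r ν ^ (-(q / 2)) * (N + 1) = ∑ μ ∈ insert ν Λ, bWeight τ r ν ^ (-(q / 2)) := by
        rw [Finset.sum_const, Finset.card_insert_of_notMem hν, hΛ.1, nsmul_eq_mul]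
        push_cast
        ring
    _ ≤ ∑ μ ∈ insert ν Λ, majorant q τ r μ := by
        refine Finset.sum_le_sum fun μ hμ => ?_
        refine le_trans ?_ (bWeight_rpow_le_majorant q hτ μ)
        refine Real.rpow_le_rpow_of_nonpos (zero_lt_one.trans_le (one_le_bWeight hτ μ)) ?_
          (by linarith)
        rcases Finset.mem_insert.1 hμ with rfl | hμ
        · exact le_rfl
        · exact hΛ.2 μ hμ ν hν
    _ ≤ A := hA _

/-- Of the available decay `1/b`, the part `b^{-q/2}` is kept for summability and the remaining
power, nonnegative since `q < 2`, is converted into decay in `N`. -/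
theorem IsNSmallest.inv_bWeight_le (hq : 0 < q) (hq2 : q < 2) (hτ : ∀ j, 0 < τ j)
    (hA : ∀ T : Finset (ι →₀ ℕ), ∑ ν ∈ T, majorant q τ r ν ≤ A) {N : ℕ} {Λ : Finset (ι →₀ ℕ)}
    (hΛ : IsNSmallest (bWeight τ r) N Λ) {ν : ι →₀ ℕ} (hν : ν ∉ Λ) :
    (bWeight τ r ν)⁻¹ ≤ (A / (N + 1)) ^ (2 / q - 1) * bWeight τ r ν ^ (-(q / 2)) := by
  have hb : 0 < bWeight τ r ν := zero_lt_one.trans_le (one_le_bWeight hτ ν)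
  have he : 0 ≤ 2 / q - 1 := by
    rw [sub_nonneg, le_div_iff₀ hq]
    linarith
  have h1 : (bWeight τ r ν)⁻¹ =
      (bWeight τ r ν ^ (-(q / 2))) ^ (2 / q - 1) * bWeight τ r ν ^ (-(q / 2)) := by
    rw [← Real.rpow_mul hb.le, ← Real.rpow_add hb, ← Real.rpow_neg_one]
    congr 1
    field_simp
    ring
  rw [h1]
  have h2 := Real.rpow_nonneg hb.le (-(q / 2))
  gcongr
  exact hΛ.bWeight_rpow_le hq hτ hA hν

theorem inv_bWeight_le_rpow (hq2 : q < 2) (hτ : ∀ j, 0 < τ j) (ν : ι →₀ ℕ) :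
    (bWeight τ r ν)⁻¹ ≤ bWeight τ r ν ^ (-(q / 2)) := by
  rw [← Real.rpow_neg_one]
  exact Real.rpow_le_rpow_of_exponent_le (one_le_bWeight hτ ν) (by linarith)

end Consequences

/-! ### Univariate quadrature of Hermite polynomials -/

/-- The univariate difference `Q_l - Q_{l-1}`, with `Q_{-1} = 0`. -/
def univDiff (Q : UnivQuad) (l : ℕ) (g : ℝ → ℝ) : ℝ :=
  if l = 0 then Q.apply 0 g else Q.apply l g - Q.apply (l - 1) g

theorem sum_univDiff (Q : UnivQuad) (n : ℕ) (g : ℝ → ℝ) :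
    ∑ l ∈ Finset.range (n + 1), univDiff Q l g = Q.apply n g := by
  induction n with
  | zero => simp [univDiff]
  | succ n ih =>
    rw [Finset.sum_range_succ, ih, univDiff, if_neg n.succ_ne_zero]
    simp

namespace UnivQuad.ExactAndBounded

variable {Q : UnivQuad}

/-- Exactness on constants forces the weights at level `0` to add up to `1`, and the only node is
the origin. -/
theorem apply_zero (hQ : Q.ExactAndBounded) (g : ℝ → ℝ) : Q.apply 0 g = g 0 := by
  have h := hQ.exact 0 1 (by simp)
  simp only [Polynomial.eval_one, UnivQuad.apply, mul_one] at h
  simp only [UnivQuad.apply, Q.node_zero, ← Finset.sum_mul]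
  rw [h]
  simp

theorem apply_hermiteFun_of_le (hQ : Q.ExactAndBounded) {l n : ℕ} (h : n ≤ l) :
    Q.apply l (hermiteFun n) = if n = 0 then 1 else 0 := by
  rw [← integral_hermiteFun, hermiteFun_eq]
  exact hQ.exact l _ ((natDegree_hermitePoly_le n).trans h)

theorem univDiff_eq_zero (hQ : Q.ExactAndBounded) {l n : ℕ} (h : n < l) : univDiff Q l (hermiteFun n) = 0 := by
  rw [univDiff, if_neg (by omega), hQ.apply_hermiteFun_of_le h.le,
    hQ.apply_hermiteFun_of_le (by omega), sub_self]

theorem univDiff_zero (hQ : Q.ExactAndBounded) (n : ℕ) : univDiff Q 0 (hermiteFun n) = hermiteFun n 0 := by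
  rw [univDiff, if_pos rfl, hQ.apply_zero]

/-- Level `0` contributes `|H_n(0)| ≤ 1`, and each of the other `n` levels is a difference of two
values of modulus at most `2`. -/
theorem sum_abs_univDiff_le (hQ : Q.ExactAndBounded) {n : ℕ} (hn : n ≠ 0) :
    ∑ l ∈ Finset.range (n + 1), |univDiff Q l (hermiteFun n)| ≤ 1 + 4 * n := by
  have hb : ∀ l, |Q.apply l (hermiteFun n)| ≤ 2 := by
    intro l
    rcases lt_or_ge l n with h | h
    · exact (hQ.bounded l n h).le
    · rw [hQ.apply_hermiteFun_of_le h, if_neg hn]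
      norm_num
  rw [Finset.sum_range_succ', add_comm]
  refine add_le_add ?_ ?_
  · rw [hQ.univDiff_zero]
    exact abs_hermiteFun_zero_le n
  · calc ∑ l ∈ Finset.range n, |univDiff Q (l + 1) (hermiteFun n)|
        ≤ ∑ l ∈ Finset.range n, (4 : ℝ) := by
          refine Finset.sum_le_sum fun l _ => ?_
          rw [univDiff, if_neg l.succ_ne_zero]
          refine (abs_sub _ _).trans ?_
          linarith [hb (l + 1), hb (l + 1 - 1)]
      _ = 4 * n := by
          rw [Finset.sum_const, Finset.card_range, nsmul_eq_mul]
          ring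

end UnivQuad.ExactAndBounded

/-! ### Sparse quadrature of tensor-product Hermite polynomials -/

section Tensor

open Classical in
theorem tensorQuad_hermiteProd (Q : UnivQuad) (s : Finset ι) (l : ι → ℕ) (ν : ι →₀ ℕ) :
    tensorQuad Q s l (hermiteProd ν) =
      (∏ j ∈ s, Q.apply (l j) (hermiteFun (ν j))) * ∏ j ∈ ν.support \ s, hermiteFun (ν j) 0 := by
  have e : ∀ k : (j : s) → Fin (Q.m (l j)), hermiteProd ν (gridPoint Q s l k) =
      (∏ j : s, hermiteFun (ν j) (Q.node (l j) (k j))) *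
        ∏ j ∈ ν.support \ s, hermiteFun (ν j) 0 := by
    intro k
    rw [hermiteProd_eq_prod (s := s ∪ ν.support \ s)
        (by rw [Finset.union_sdiff_self_eq_union]; exact Finset.subset_union_right),
      Finset.prod_union Finset.disjoint_sdiff, ← Finset.prod_coe_sort s]
    congr 1
    · refine Finset.prod_congr rfl fun j _ => ?_
      simp [gridPoint]
    · refine Finset.prod_congr rfl fun j hj => ?_
      simp [gridPoint, (Finset.mem_sdiff.1 hj).2]
  simp only [tensorQuad, e, smul_eq_mul, ← mul_assoc, ← Finset.prod_mul_distrib]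
  rw [← Finset.sum_mul, ← Finset.prod_coe_sort s]
  congr 1
  simp only [UnivQuad.apply]
  rw [Finset.prod_univ_sum, Fintype.piFinset_univ]

-- The signed sum over subsets is the expansion of a product of differences; coordinates outside
-- `supp lam` are evaluated at the origin.
open Classical in
theorem diffQuad_hermiteProd (Q : UnivQuad) (lam ν : ι →₀ ℕ) :
    diffQuad Q lam (hermiteProd ν) =
      (∏ j ∈ lam.support, univDiff Q (lam j) (hermiteFun (ν j))) *
        ∏ j ∈ ν.support \ lam.support, hermiteFun (ν j) 0 := by
  have e : ∏ j ∈ lam.support, univDiff Q (lam j) (hermiteFun (ν j)) =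
      ∏ j ∈ lam.support, (-Q.apply (lam j - 1) (hermiteFun (ν j)) +
        Q.apply (lam j) (hermiteFun (ν j))) := by
    refine Finset.prod_congr rfl fun j hj => ?_
    rw [univDiff, if_neg (Finsupp.mem_support_iff.1 hj)]
    ring
  rw [e, Finset.prod_add, Finset.sum_mul, diffQuad]
  refine Finset.sum_congr (by congr!) fun A hA => ?_
  rw [tensorQuad_hermiteProd, smul_eq_mul, ← mul_assoc,
    ← Finset.prod_sdiff (Finset.mem_powerset.1 hA), Finset.prod_neg]
  have h1 : ∏ j ∈ lam.support \ A, Q.apply (if j ∈ A then lam j - 1 else lam j)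
      (hermiteFun (ν j)) = ∏ j ∈ lam.support \ A, Q.apply (lam j) (hermiteFun (ν j)) :=
    Finset.prod_congr rfl fun j hj => by rw [if_neg (Finset.mem_sdiff.1 hj).2]
  have h2 : ∏ j ∈ A, Q.apply (if j ∈ A then lam j - 1 else lam j) (hermiteFun (ν j)) =
      ∏ j ∈ A, Q.apply (lam j - 1) (hermiteFun (ν j)) :=
    Finset.prod_congr rfl fun j hj => by rw [if_pos hj]
  rw [h1, h2]
  congr 1
  ring

/-- Evaluation at `0` is the level-`0` rule, so with `Q_{-1} = 0` the coordinates where `lam`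
vanishes need no separate treatment. -/
theorem diffQuad_hermiteProd_of_le {Q : UnivQuad} (hQ : Q.ExactAndBounded) {lam ν : ι →₀ ℕ}
    (h : lam ≤ ν) : diffQuad Q lam (hermiteProd ν) =
      ∏ j ∈ ν.support, univDiff Q (lam j) (hermiteFun (ν j)) := by
  classical
  rw [diffQuad_hermiteProd, ← Finset.prod_sdiff (Finsupp.support_mono h), mul_comm]
  congr 1
  refine Finset.prod_congr (by congr!) fun j hj => ?_
  rw [Finsupp.notMem_support_iff.1 (Finset.mem_sdiff.1 hj).2, hQ.univDiff_zero]

theorem diffQuad_hermiteProd_of_not_le {Q : UnivQuad} (hQ : Q.ExactAndBounded) {lam ν : ι →₀ ℕ}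
    (h : ¬ lam ≤ ν) : diffQuad Q lam (hermiteProd ν) = 0 := by
  classical
  rw [Finsupp.le_def, not_forall] at h
  obtain ⟨j, hj⟩ := h
  rw [not_le] at hj
  rw [diffQuad_hermiteProd, Finset.prod_eq_zero (i := j) (Finsupp.mem_support_iff.2 (by omega))
    (hQ.univDiff_eq_zero hj), zero_mul]

theorem mem_finsupp_range_iff {lam ν : ι →₀ ℕ} :
    lam ∈ ν.support.finsupp (fun j => Finset.range (ν j + 1)) ↔ lam ≤ ν := by
  rw [Finset.mem_finsupp_iff]
  constructor
  · rintro ⟨h1, h2⟩ j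
    by_cases hj : j ∈ ν.support
    · exact Nat.lt_succ_iff.1 (Finset.mem_range.1 (h2 j hj))
    · rw [Finsupp.notMem_support_iff.1 fun h => hj (h1 h)]
      exact Nat.zero_le _
  · exact fun h => ⟨Finsupp.support_mono h, fun j _ => Finset.mem_range.2 (Nat.lt_succ_of_le (h j))⟩

open Classical in
theorem integral_hermiteProd (ν : ι →₀ ℕ) :
    ∫ y, hermiteProd ν y ∂(gaussProd ι) = if ν = 0 then 1 else 0 := by
  have := integral_hermiteProd_mul ν 0
  simpa [hermiteProd] using this

-- Admissibility puts every `lam ≤ ν` into `Λ`, and all other differences annihilate `H_ν`. The sum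
-- over the full box telescopes to `∏ Q_{ν_j}(H_{ν_j})`, where each rule is exact.
open Classical in
theorem sparseQuad_hermiteProd_of_mem {Q : UnivQuad} (hQ : Q.ExactAndBounded)
    {Λ : Finset (ι →₀ ℕ)} (hΛ : Admissible Λ) {ν : ι →₀ ℕ} (hν : ν ∈ Λ) :
    sparseQuad Q Λ (hermiteProd ν) = if ν = 0 then 1 else 0 := by
  have hsub : ν.support.finsupp (fun j => Finset.range (ν j + 1)) ⊆ Λ := fun lam hlam =>
    hΛ ν hν lam (mem_finsupp_range_iff.1 hlam)
  rw [sparseQuad, ← Finset.sum_subset hsub fun lam _ hlam =>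
    diffQuad_hermiteProd_of_not_le hQ fun h => hlam (mem_finsupp_range_iff.2 h)]
  rw [Finset.sum_congr rfl fun lam hlam =>
    diffQuad_hermiteProd_of_le hQ (mem_finsupp_range_iff.1 hlam),
    sum_finsupp_prod _ _ (fun j l => univDiff Q l (hermiteFun (ν j)))]
  simp only [sum_univDiff, hQ.apply_hermiteFun_of_le le_rfl]
  split_ifs with h
  · simp [h]
  · obtain ⟨j, hj⟩ := Finsupp.support_nonempty_iff.2 h
    exact Finset.prod_eq_zero hj (if_neg (Finsupp.mem_support_iff.1 hj))

/-- Only `lam ≤ ν` contribute; enlarging the sum of absolute values to the whole box makes it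
factorise, whatever the shape of `Λ`. -/
theorem abs_sparseQuad_hermiteProd_le {Q : UnivQuad} (hQ : Q.ExactAndBounded)
    (Λ : Finset (ι →₀ ℕ)) (ν : ι →₀ ℕ) :
    |sparseQuad Q Λ (hermiteProd ν)| ≤ ν.prod fun _ n => (1 + 4 * n : ℝ) := by
  classical
  calc |sparseQuad Q Λ (hermiteProd ν)|
      ≤ ∑ lam ∈ Λ, |diffQuad Q lam (hermiteProd ν)| := Finset.abs_sum_le_sum_abs _ _
    _ = ∑ lam ∈ Λ with lam ≤ ν, |diffQuad Q lam (hermiteProd ν)| := by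
        rw [Finset.sum_filter]
        refine Finset.sum_congr rfl fun lam _ => ?_
        split_ifs with h
        · rfl
        · rw [diffQuad_hermiteProd_of_not_le hQ h, abs_zero]
    _ = ∑ lam ∈ Λ with lam ≤ ν, ∏ j ∈ ν.support, |univDiff Q (lam j) (hermiteFun (ν j))| := by
        refine Finset.sum_congr rfl fun lam hlam => ?_
        rw [diffQuad_hermiteProd_of_le hQ (Finset.mem_filter.1 hlam).2, Finset.abs_prod]
    _ ≤ ∑ lam ∈ ν.support.finsupp (fun j => Finset.range (ν j + 1)),
          ∏ j ∈ ν.support, |univDiff Q (lam j) (hermiteFun (ν j))| :=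
        Finset.sum_le_sum_of_subset_of_nonneg
          (fun lam hlam => mem_finsupp_range_iff.2 (Finset.mem_filter.1 hlam).2)
          fun lam _ _ => Finset.prod_nonneg fun j _ => abs_nonneg _
    _ = ∏ j ∈ ν.support, ∑ l ∈ Finset.range (ν j + 1), |univDiff Q l (hermiteFun (ν j))| :=
        sum_finsupp_prod _ _ (fun j l => |univDiff Q l (hermiteFun (ν j))|)
    _ ≤ ν.prod fun _ n => (1 + 4 * n : ℝ) :=
        Finset.prod_le_prod (fun j _ => Finset.sum_nonneg fun _ _ => abs_nonneg _) fun j hj =>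
          hQ.sum_abs_univDiff_le (Finsupp.mem_support_iff.1 hj)

/-- The error of the sparse quadrature on Hermite polynomials with indices outside `Λ`. -/
theorem abs_integral_sub_sparseQuad_hermiteProd_le {Q : UnivQuad} (hQ : Q.ExactAndBounded)
    {Λ : Finset (ι →₀ ℕ)} (hΛ : Admissible Λ) {ν : ι →₀ ℕ} (hν : ν ∉ Λ) :
    |∫ y, hermiteProd ν y ∂(gaussProd ι) - sparseQuad Q Λ (hermiteProd ν)| ≤
      ν.prod fun _ n => (1 + 4 * n : ℝ) := by
  rw [integral_hermiteProd]
  split_ifs with h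
  -- An admissible set that misses `0` is empty, so the error is the integral `1` itself.
  · subst h
    have : Λ = ∅ := Finset.eq_empty_of_forall_notMem fun lam hlam =>
      hν (hΛ lam hlam 0 fun j => Nat.zero_le _)
    simp [this, sparseQuad]
  · rw [zero_sub, abs_neg]
    exact abs_sparseQuad_hermiteProd_le hQ Λ ν

theorem integral_sub_sparseQuad_hermiteProd_of_mem {Q : UnivQuad} (hQ : Q.ExactAndBounded)
    {Λ : Finset (ι →₀ ℕ)} (hΛ : Admissible Λ) {ν : ι →₀ ℕ} (hν : ν ∈ Λ) :
    ∫ y, hermiteProd ν y ∂(gaussProd ι) - sparseQuad Q Λ (hermiteProd ν) = 0 := by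
  rw [integral_hermiteProd, sparseQuad_hermiteProd_of_mem hQ hΛ hν, sub_self]

/-! ### Linearity and termwise evaluation -/

theorem finite_support_gridPoint (Q : UnivQuad) (s : Finset ι) (l : ι → ℕ)
    (k : (j : s) → Fin (Q.m (l j))) : {j | gridPoint Q s l k j ≠ 0}.Finite := by
  refine s.finite_toSet.subset fun j hj => ?_
  by_contra h
  exact hj (dif_neg h)

theorem map_sparseQuad {S : Type*} [NormedAddCommGroup S] [NormedSpace ℝ S] (L : S →L[ℝ] ℝ)
    (Q : UnivQuad) (Λ : Finset (ι →₀ ℕ)) (f : (ι → ℝ) → S) :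
    L (sparseQuad Q Λ f) = sparseQuad Q Λ fun y => L (f y) := by
  simp only [sparseQuad, diffQuad, tensorQuad, map_sum, map_smul]

/-- Sparse quadrature is a finite combination of values at grid points, all of which have finitely
many nonzero coordinates. -/
theorem hasSum_sparseQuad {κ : Type*} (Q : UnivQuad) (Λ : Finset (ι →₀ ℕ)) {x : κ → ℝ}
    {h : κ → (ι → ℝ) → ℝ} {g : (ι → ℝ) → ℝ}
    (hg : ∀ y : ι → ℝ, {j | y j ≠ 0}.Finite → HasSum (fun i => x i * h i y) (g y)) :
    HasSum (fun i => x i * sparseQuad Q Λ (h i)) (sparseQuad Q Λ g) := by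
  have ht : ∀ (s : Finset ι) (l : ι → ℕ),
      HasSum (fun i => x i * tensorQuad Q s l (h i)) (tensorQuad Q s l g) := by
    intro s l
    simp only [tensorQuad, Finset.mul_sum, smul_eq_mul]
    refine hasSum_sum fun k _ => ?_
    refine ((hg _ (finite_support_gridPoint Q s l k)).mul_left _).congr_fun fun i => ?_
    ring
  simp only [sparseQuad, diffQuad, Finset.mul_sum, smul_eq_mul]
  refine hasSum_sum fun ν _ => hasSum_sum fun A _ => ?_
  refine ((ht _ _).mul_left _).congr_fun fun i => ?_
  ring

end Tensor

/-! ### The error estimate -/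

theorem sum_abs_mul_le_sqrt_mul_sqrt {κ : Type*} {b : κ → ℝ} (hb : ∀ i, 0 < b i) (x p : κ → ℝ)
    (T : Finset κ) :
    ∑ i ∈ T, |x i| * p i ≤ √(∑ i ∈ T, b i * x i ^ 2) * √(∑ i ∈ T, p i ^ 2 * (b i)⁻¹) := by
  refine le_of_eq_of_le ?_ ((Real.sum_mul_le_sqrt_mul_sqrt T (fun i => √(b i) * |x i|)
    (fun i => p i * (√(b i))⁻¹)).trans_eq ?_)
  · refine Finset.sum_congr rfl fun i _ => ?_
    have := Real.sqrt_pos.2 (hb i)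
    field_simp
  · simp only [mul_pow, inv_pow, sq_abs, Real.sq_sqrt (hb _).le]

theorem IsAverageValueAt.clm_comp {S : Type*} [NormedAddCommGroup S] [NormedSpace ℝ S]
    [CompleteSpace S] (L : S →L[ℝ] ℝ) {f : (ι → ℝ) → S} (hf : Integrable f (gaussProd ι))
    {y : ι → ℝ} (h : IsAverageValueAt f y) : IsAverageValueAt (fun z => L (f z)) y := by
  obtain ⟨w, hw, hbox, hlim⟩ := h
  refine ⟨w, hw, hbox, ((L.continuous.tendsto _).comp hlim).congr fun ε => ?_⟩
  simp only [Function.comp_apply, setAverage_eq, map_smul]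
  rw [L.integral_comp_comm hf.integrableOn]

variable [Countable ι] {S : Type*} [NormedAddCommGroup S] [NormedSpace ℝ S] [CompleteSpace S]
  {q : ℝ} {τ : ι → ℝ} {r : ℕ} {A : ℝ} {f : (ι → ℝ) → S} {D : (ι →₀ ℕ) → (ι → ℝ) → S}

/-- By Cauchy-Schwarz, the energy bound and `∑ majorant ≤ A` give the coefficient decay that the
pointwise expansion requires; the powers of `centredBound` are in `majorant` for this purpose. -/
theorem HasMixedDerivs.hasSum_hermiteProd (hq2 : q < 2) (hτ : ∀ j, 0 < τ j)
    (hA : ∀ T : Finset (ι →₀ ℕ), ∑ ν ∈ T, majorant q τ r ν ≤ A) (hD : HasMixedDerivs τ r f D)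
    {L : S →L[ℝ] ℝ} (hL : ‖L‖ ≤ 1) {y : ι → ℝ} (hy : {j | y j ≠ 0}.Finite)
    (hav : IsAverageValueAt f y) :
    HasSum (fun ν : ι →₀ ℕ => (∫ z, hermiteProd ν z * L (f z) ∂(gaussProd ι)) * hermiteProd ν y)
      (L (f y)) := by
  have hf : MemLp f 2 (gaussProd ι) := hD.zero ▸ hD.memLp 0 (by simp)
  refine hasSum_hermiteProd_of_isAverageValueAt (L.comp_memLp' hf) ?_ hy
    (hav.clm_comp L (hf.integrable one_le_two))
  have hcb : 0 ≤ centredBound := zero_le_one.trans one_le_centredBound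
  have hb := fun ν => zero_lt_one.trans_le (one_le_bWeight (r := r) hτ ν)
  refine summable_of_sum_le (c := √(energy τ r D) * √A)
    (fun ν => mul_nonneg (abs_nonneg _) (pow_nonneg hcb _)) fun T => ?_
  refine (sum_abs_mul_le_sqrt_mul_sqrt hb _ _ T).trans ?_
  gcongr
  · exact hD.sum_bWeight_mul_sq_le hτ hL T
  · refine (Finset.sum_le_sum fun ν _ => ?_).trans (hA T)
    rw [majorant]
    refine mul_le_mul ?_ (inv_bWeight_le_rpow hq2 hτ ν) (inv_nonneg.2 (hb ν).le) (by positivity)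
    exact le_mul_of_one_le_right (by positivity) (one_le_pow₀ (one_le_prod_one_add ν))

theorem HasMixedDerivs.norm_integral_sub_sparseQuad_le (hq : 0 < q) (hq2 : q < 2)
    (hτ : ∀ j, 0 < τ j) (hA0 : 0 < A)
    (hA : ∀ T : Finset (ι →₀ ℕ), ∑ ν ∈ T, majorant q τ r ν ≤ A) (hr : 1 ≤ r) {N : ℕ}
    {Λ : Finset (ι →₀ ℕ)} (hΛ : IsNSmallest (bWeight τ r) N Λ) {Q : UnivQuad}
    (hQ : Q.ExactAndBounded) (hD : HasMixedDerivs τ r f D)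
    (hav : ∀ y : ι → ℝ, {j | y j ≠ 0}.Finite → IsAverageValueAt f y) :
    ‖(∫ y, f y ∂(gaussProd ι)) - sparseQuad Q Λ f‖ ≤
      A ^ (1 / q) * √(energy τ r D) * ((N : ℝ) + 1) ^ (-(1 / q - 1 / 2)) := by
  classical
  have hf : MemLp f 2 (gaussProd ι) := hD.zero ▸ hD.memLp 0 (by simp)
  -- A functional norming the error vector reduces the estimate to the scalar function `L ∘ f`.
  obtain ⟨L, hL, hLn⟩ := exists_dual_vector'' ℝ ((∫ y, f y ∂(gaussProd ι)) - sparseQuad Q Λ f)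
  have hadm := hΛ.admissible hr hτ
  have hb := fun ν => zero_lt_one.trans_le (one_le_bWeight (r := r) hτ ν)
  set x : (ι →₀ ℕ) → ℝ := fun ν => ∫ z, hermiteProd ν z * L (f z) ∂(gaussProd ι) with hx
  set e : (ι →₀ ℕ) → ℝ := fun ν =>
    ∫ y, hermiteProd ν y ∂(gaussProd ι) - sparseQuad Q Λ (hermiteProd ν) with he
  have hint : L (∫ y, f y ∂(gaussProd ι)) = x 0 := by
    rw [← L.integral_comp_comm (hf.integrable one_le_two)]
    simp [hx, hermiteProd]
  have hs1 : HasSum (fun ν => x ν * ∫ y, hermiteProd ν y ∂(gaussProd ι)) (x 0) := by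
    have := hasSum_single (f := fun ν => x ν * ∫ y, hermiteProd ν y ∂(gaussProd ι)) 0
      fun ν hν => by rw [integral_hermiteProd, if_neg hν, mul_zero]
    simpa [integral_hermiteProd] using this
  have hs : HasSum (fun ν => x ν * e ν) ‖(∫ y, f y ∂(gaussProd ι)) - sparseQuad Q Λ f‖ := by
    have h2 := hasSum_sparseQuad Q Λ (g := fun y => L (f y)) fun y hy =>
      hD.hasSum_hermiteProd hq2 hτ hA hL hy (hav y hy)
    have h3 := hs1.sub h2
    rw [← map_sparseQuad, ← hint, ← map_sub, hLn] at h3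
    refine h3.congr_fun fun ν => ?_
    simp only [he]
    ring
  refine le_of_tendsto' hs fun T => ?_
  have hN : (0 : ℝ) < (N : ℝ) + 1 := by positivity
  calc ∑ ν ∈ T, x ν * e ν = ∑ ν ∈ T \ Λ, x ν * e ν := by
        rw [← Finset.sum_subset Finset.sdiff_subset fun ν hν hν' => ?_]
        have : ν ∈ Λ := by
          by_contra h
          exact hν' (Finset.mem_sdiff.2 ⟨hν, h⟩)
        simp only [he, integral_sub_sparseQuad_hermiteProd_of_mem hQ hadm this, mul_zero]
    _ ≤ ∑ ν ∈ T \ Λ, |x ν| * ν.prod fun _ n => (1 + 4 * n : ℝ) := by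
        refine Finset.sum_le_sum fun ν hν => ?_
        refine (le_abs_self _).trans ?_
        rw [abs_mul]
        gcongr
        exact abs_integral_sub_sparseQuad_hermiteProd_le hQ hadm (Finset.mem_sdiff.1 hν).2
    _ ≤ √(∑ ν ∈ T \ Λ, bWeight τ r ν * x ν ^ 2) *
          √(∑ ν ∈ T \ Λ, (ν.prod fun _ n => (1 + 4 * n : ℝ)) ^ 2 * (bWeight τ r ν)⁻¹) :=
        sum_abs_mul_le_sqrt_mul_sqrt hb _ _ _
    _ ≤ √(energy τ r D) * √((A / (N + 1)) ^ (2 / q - 1) * A) := by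
        gcongr
        · exact hD.sum_bWeight_mul_sq_le hτ hL _
        · calc ∑ ν ∈ T \ Λ, (ν.prod fun _ n => (1 + 4 * n : ℝ)) ^ 2 * (bWeight τ r ν)⁻¹
              ≤ ∑ ν ∈ T \ Λ, (A / (N + 1)) ^ (2 / q - 1) * majorant q τ r ν := by
                refine Finset.sum_le_sum fun ν hν => ?_
                have h1 := hΛ.inv_bWeight_le hq hq2 hτ hA (Finset.mem_sdiff.1 hν).2
                have h2 := Real.rpow_nonneg (hb ν).le (-(q / 2))
                calc (ν.prod fun _ n => (1 + 4 * n : ℝ)) ^ 2 * (bWeight τ r ν)⁻¹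
                    ≤ (ν.prod fun _ n => (1 + 4 * n : ℝ)) ^ 2 *
                        ((A / (N + 1)) ^ (2 / q - 1) * bWeight τ r ν ^ (-(q / 2))) := by gcongr
                  _ = (A / (N + 1)) ^ (2 / q - 1) * (1 *
                        (ν.prod fun _ n => (1 + 4 * n : ℝ)) ^ 2 * bWeight τ r ν ^ (-(q / 2))) := by
                      ring
                  _ ≤ (A / (N + 1)) ^ (2 / q - 1) * majorant q τ r ν := by
                      rw [majorant]
                      gcongr
                      exact one_le_pow₀ (one_le_pow₀ one_le_centredBound)
            _ ≤ (A / (N + 1)) ^ (2 / q - 1) * A := by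
                rw [← Finset.mul_sum]
                gcongr
                exact hA _
    _ = A ^ (1 / q) * √(energy τ r D) * ((N : ℝ) + 1) ^ (-(1 / q - 1 / 2)) := by
        -- The exponent of `A` is `(2/q - 1) + 1 = 2 · (1/q)`, that of `N + 1` is `-(2/q - 1) = 2 ·
        -- (-(1/q - 1/2))`.
        have h1 : (A / (N + 1)) ^ (2 / q - 1) * A =
            (A ^ (1 / q) * ((N : ℝ) + 1) ^ (-(1 / q - 1 / 2))) ^ 2 := by
          rw [mul_pow, ← Real.rpow_natCast, ← Real.rpow_natCast, ← Real.rpow_mul hA0.le,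
            ← Real.rpow_mul hN.le, Real.div_rpow hA0.le hN.le, div_eq_mul_inv,
            ← Real.rpow_neg hN.le, mul_right_comm]
          nth_rewrite 2 [← Real.rpow_one A]
          rw [← Real.rpow_add hA0]
          congr 2 <;> push_cast <;> ring
        rw [h1, Real.sqrt_sq (by positivity)]
        ring

end

end SparseQuad

theorem theorem3p5
    (q : ℝ) (hq0 : 0 < q) (hq2 : q < 2)
    (τ : ℕ → ℝ) (hτ : ∀ j, 0 < τ j) (hτq : Summable fun j => (τ j)⁻¹ ^ q)
    (r : ℕ) (hr : 14 / q < r) :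
    ∃ C : ℝ, ∀ J : ℕ∞, 1 ≤ J → ∀ N : ℕ,
      (∃ Λ : Finset (SparseQuad.Coord J →₀ ℕ),
        SparseQuad.IsNSmallest (SparseQuad.bWeight (fun j : SparseQuad.Coord J => τ j) r) N Λ) ∧
      ∀ Λ : Finset (SparseQuad.Coord J →₀ ℕ),
        SparseQuad.IsNSmallest (SparseQuad.bWeight (fun j : SparseQuad.Coord J => τ j) r) N Λ →
        SparseQuad.Admissible Λ ∧
        ∀ (Q : SparseQuad.UnivQuad), Q.ExactAndBounded →
        ∀ (S : Type*) [NormedAddCommGroup S] [NormedSpace ℝ S] [CompleteSpace S]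
          (f : (SparseQuad.Coord J → ℝ) → S)
          (D : (SparseQuad.Coord J →₀ ℕ) → (SparseQuad.Coord J → ℝ) → S),
          SparseQuad.HasMixedDerivs (fun j : SparseQuad.Coord J => τ j) r f D →
          (∀ y : SparseQuad.Coord J → ℝ, {j | y j ≠ 0}.Finite →
            SparseQuad.IsAverageValueAt f y) →
          ‖(∫ y, f y ∂(SparseQuad.gaussProd (SparseQuad.Coord J))) -
              SparseQuad.sparseQuad Q Λ f‖ ≤
            C * √(SparseQuad.energy (fun j : SparseQuad.Coord J => τ j) r D) *
              ((N : ℝ) + 1) ^ (-(1 / q - 1 / 2)) := by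
  have hr0 : (0 : ℝ) < r := (by positivity : (0 : ℝ) < 14 / q).trans hr
  have hr1 : 1 ≤ r := by exact_mod_cast hr0
  have hr8 : 8 / q ≤ r := by
    refine le_trans ?_ hr.le
    gcongr
    norm_num
  obtain ⟨A, hA0, hA⟩ := SparseQuad.exists_sum_majorant_le hq0 hτ hτq hr8 hr1
  refine ⟨A ^ (1 / q), fun J hJ N => ?_⟩
  have hτ' : ∀ j : SparseQuad.Coord J, 0 < τ j := fun j => hτ j
  refine ⟨?_, fun Λ hΛ => ⟨SparseQuad.IsNSmallest.admissible hr1 hτ' hΛ,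
    fun Q hQ S _ _ _ f D hD hav => SparseQuad.HasMixedDerivs.norm_integral_sub_sparseQuad_le hq0 hq2
      hτ' hA0 (hA J) hr1 hΛ hQ hD hav⟩⟩
  -- A coordinate exists since `J ≥ 1`, so there are infinitely many multi-indices to choose from.
  have : Nonempty (SparseQuad.Coord J) := ⟨⟨0, by
    rw [Nat.cast_zero]
    exact zero_lt_one.trans_le hJ⟩⟩
  exact SparseQuad.exists_isNSmallest
    (SparseQuad.finite_bWeight_le hq0 hτ' (hA J)) N
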